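/- Let $\Delta\subset\mathbb R^n$ be a Delzant polytope, i.e. the convex hull of a nonempty finite set of integer points such that each vertex $v$ has a neighbourhood in which $\Delta$ coincides with $\{v+\sum_i c_ib_i : c_i\ge 0\}$ for some basis $b_1,\dots,b_n$ of $\mathbb Z^n$. Let $X_\Delta$ be the associated toric manifold, i.e. the closure of $\{[t^\alpha]_{\alpha\in\Delta\cap\mathbb Z^n}: t\in(\mathbb C^*)^n\}$ in projective space, with the ample line bundle $L=L_\Delta=\mathcal O(1)|_{X_\Delta}$, and let $p\in X_\Delta$ be a fixed point of the action of $(\mathbb C^*)^n$. A growth condition $u+O(1)$ on a complex vector space $V$ is the class of a plurisubharmonic function $u$ on $V$, two such functions being equivalent if their difference is bounded. Canonical growth condition. Choose a smooth hermitian metric $e^{-\phi}$ on $L$ and a trivialization of $L$ near $p$. For a holomorphic section $s$ of $kL=L^{\otimes k}$ let $s_{hom}$, a homogeneous polynomial on $T_pX_\Delta$, be the leading order homogeneous part of the Taylor series of $s$ at $p$, and let $B_1(kL,k\phi)=\{s\in H^0(X_\Delta,kL):\sup_{X_\Delta}|s|^2e^{-k\phi}\le 1\}$. Put $$\phi_{L,p}:=\sup{}^*\left\{\tfrac1k\ln|s_{hom}|^2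 : s\in B_1(kL,k\phi)\setminus\{0\},\ k\ge 1\right\},$$ where $*$ denotes the upper semicontinuous regularization on $T_pX_\Delta$. Toric growth condition. The point $p$ corresponds to a vertex $v$ of $\Delta$: there is an affine chart $\mathbb C^n\subseteq X_\Delta$ centred at $p$ whose coordinates are the characters $z_i=t^{b_i}$ given by the basis $b$ at $v$. Use it to identify $T_pX_\Delta$ with $\mathbb C^n$, and move $\Delta$ by the integral affine transformation that takes $v$ to $0$ and $b$ to the standard basis, so that $\Delta$ lies in the positive orthant. For $k\ge 1$ put $$\phi_{\Delta,p}(z):=\frac1k\log\sum_{\alpha\in k\Delta\cap\mathbb Z^n}|z^\alpha|^2 .$$ Theorem. For every smooth metric $\phi$ of $L_\Delta$ and every $k\ge1$, the functions $\phi_{L_\Delta,p}$ and $\phi_{\Delta,p}$ are plurisubharmonic on $T_pX_\Delta$ and $$\phi_{L_\Delta,p}+O(1)=\phi_{\Delta,p}+O(1),$$ that is, $\phi_{L_\Delta,p}-\phi_{\Delta,p}$ is bounded on $T_pX_\Delta$. -/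

import Mathlib

open Set Filter Topology
open scoped Manifold ContDiff LinearAlgebra.Projectivization Pointwise

noncomputable section

/-! ### Plurisubharmonic functions and growth conditions -/

/-- A function `u : V → [-∞, ∞)` on a complex topological vector space is plurisubharmonic if it is
upper semicontinuous and satisfies the sub-mean value inequality
`u z ≤ (2π)⁻¹ ∫ u (z + e^{iθ} w) dθ` on all complex circles.  As `u` is upper semicontinuous and
bounded above on the compact circle, the integral (possibly `-∞`) is the infimum of the integrals of
the continuous majorants of `u` on the circle; this is how the inequality is expressed here. -/
def IsPlurisubharmonic {V : Type*} [AddCommGroup V] [Module ℂ V] [TopologicalSpace V]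
    (u : V → EReal) : Prop :=
  (∀ z, u z ≠ ⊤) ∧ UpperSemicontinuous u ∧
    ∀ (z w : V) (h : ℂ → ℝ), ContinuousOn h (Metric.sphere 0 1) →
      (∀ ζ ∈ Metric.sphere (0 : ℂ) 1, u (z + ζ • w) ≤ (h ζ : EReal)) →
      u z ≤ ((Real.circleAverage h 0 1 : ℝ) : EReal)

/-- Two functions with values in `[-∞, ∞]` are equivalent if they differ by a bounded term. -/
def BoundedDifference {V : Type*} (u v : V → EReal) : Prop :=
  ∃ C : ℝ, ∀ z, u z ≤ v z + (C : EReal) ∧ v z ≤ u z + (C : EReal)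

lemma BoundedDifference.refl {V : Type*} (u : V → EReal) : BoundedDifference u u :=
  ⟨0, fun z => by simp⟩

lemma BoundedDifference.symm {V : Type*} {u v : V → EReal} (h : BoundedDifference u v) :
    BoundedDifference v u :=
  let ⟨C, hC⟩ := h
  ⟨C, fun z => ⟨(hC z).2, (hC z).1⟩⟩

lemma BoundedDifference.trans {V : Type*} {u v w : V → EReal} (h : BoundedDifference u v)
    (h' : BoundedDifference v w) : BoundedDifference u w := by
  obtain ⟨C, hC⟩ := h
  obtain ⟨D, hD⟩ := h'
  refine ⟨C + D, fun z => ⟨?_, ?_⟩⟩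
  · calc u z ≤ v z + (C : EReal) := (hC z).1
      _ ≤ (w z + (D : EReal)) + (C : EReal) := by gcongr; exact (hD z).1
      _ = w z + ((C + D : ℝ) : EReal) := by rw [add_assoc, ← EReal.coe_add, add_comm D C]
  · calc w z ≤ v z + (D : EReal) := (hD z).2
      _ ≤ (u z + (C : EReal)) + (D : EReal) := by gcongr; exact (hC z).2
      _ = u z + ((C + D : ℝ) : EReal) := by rw [add_assoc, ← EReal.coe_add]

/-- The equivalence relation "`u = v + O(1)`" on plurisubharmonic functions. -/
def growthSetoid (V : Type*) [AddCommGroup V] [Module ℂ V] [TopologicalSpace V] :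
    Setoid {u : V → EReal // IsPlurisubharmonic u} where
  r u v := BoundedDifference u.1 v.1
  iseqv := ⟨fun u => .refl u.1, fun h => h.symm, fun h h' => h.trans h'⟩

/-- A growth condition on a complex vector space `V` is an equivalence class of plurisubharmonic
functions on `V`, two such functions being equivalent if their difference is bounded. -/
def GrowthCondition (V : Type*) [AddCommGroup V] [Module ℂ V] [TopologicalSpace V] : Type _ :=
  Quotient (growthSetoid V)

/-- The growth condition `u + O(1)` of a plurisubharmonic function `u`. -/
def GrowthCondition.mk {V : Type*} [AddCommGroup V] [Module ℂ V] [TopologicalSpace V]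
    (u : V → EReal) (hu : IsPlurisubharmonic u) : GrowthCondition V :=
  Quotient.mk (growthSetoid V) ⟨u, hu⟩

/-! ### Holomorphic line bundles, sections, metrics, and the canonical growth function -/

/-- A holomorphic line bundle on a complex manifold `M` (modelled on `E`), given by an open cover
and a holomorphic cocycle of transition functions. -/
structure HolomorphicLineBundle (E : Type*) [NormedAddCommGroup E] [NormedSpace ℂ E]
    (M : Type*) [TopologicalSpace M] [ChartedSpace E M] where
  /-- index set of the trivializing cover -/
  ι : Type
  /-- the trivializing open sets -/
  U : ι → Set M
  isOpen_U : ∀ i, IsOpen (U i)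
  cover : ∀ x, ∃ i, x ∈ U i
  /-- the transition functions: a section is a family of functions with `f i = g i j * f j` -/
  g : ι → ι → M → ℂ
  g_ne_zero : ∀ i j, ∀ x ∈ U i ∩ U j, g i j x ≠ 0
  g_holomorphic : ∀ i j, MDifferentiableOn 𝓘(ℂ, E) 𝓘(ℂ, ℂ) (g i j) (U i ∩ U j)
  g_cocycle : ∀ i j k, ∀ x ∈ U i ∩ U j ∩ U k, g i j x * g j k x = g i k x

namespace HolomorphicLineBundle

variable {E : Type*} [NormedAddCommGroup E] [NormedSpace ℂ E]
  {M : Type*} [TopologicalSpace M] [ChartedSpace E M]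

/-- The `k`-th tensor power `kL` of a line bundle `L`. -/
def tensorPower (L : HolomorphicLineBundle E M) (k : ℕ) : HolomorphicLineBundle E M where
  ι := L.ι
  U := L.U
  isOpen_U := L.isOpen_U
  cover := L.cover
  g i j x := L.g i j x ^ k
  g_ne_zero i j x hx := pow_ne_zero _ (L.g_ne_zero i j x hx)
  g_holomorphic i j x hx :=
    ((differentiable_pow k).differentiableAt.mdifferentiableAt).comp_mdifferentiableWithinAt x
      (L.g_holomorphic i j x hx)
  g_cocycle i j l x hx := by rw [← mul_pow, L.g_cocycle i j l x hx]

/-- Global holomorphic sections of `L`: families of holomorphic functions on the trivializing open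
sets, related by the transition functions.  (The values of `f i` off `U i` play no role.) -/
structure HolomorphicSection (L : HolomorphicLineBundle E M) where
  f : L.ι → M → ℂ
  holomorphic : ∀ i, MDifferentiableOn 𝓘(ℂ, E) 𝓘(ℂ, ℂ) (f i) (L.U i)
  compatible : ∀ i j, ∀ x ∈ L.U i ∩ L.U j, f i x = L.g i j x * f j x

/-- Smooth hermitian metrics `e^{-φ}` of `L`, in additive notation: families of smooth real
functions on the trivializing open sets with `φ i = φ j + ln |g i j|²`. -/
structure SmoothMetric (L : HolomorphicLineBundle E M) where
  φ : L.ι → M → ℝ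
  smooth : ∀ i, ContMDiffOn 𝓘(ℝ, E) 𝓘(ℝ, ℝ) ∞ (φ i) (L.U i)
  compatible : ∀ i j, ∀ x ∈ L.U i ∩ L.U j, φ i x = φ j x + Real.log (‖L.g i j x‖ ^ 2)

/-- The metric `kφ` of `kL`. -/
def SmoothMetric.tensorPower {L : HolomorphicLineBundle E M} (m : L.SmoothMetric) (k : ℕ) :
    (L.tensorPower k).SmoothMetric where
  φ i x := (k : ℝ) * m.φ i x
  smooth i := contMDiffOn_const.mul (m.smooth i)
  compatible i j x hx := by
    have h := m.compatible i j x hx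
    have h' : ‖(L.tensorPower k).g i j x‖ ^ 2 = (‖L.g i j x‖ ^ 2) ^ k := by
      simp only [HolomorphicLineBundle.tensorPower, norm_pow]
      rw [← pow_mul, ← pow_mul, mul_comm]
    rw [h', Real.log_pow, h, mul_add]

namespace HolomorphicSection

/-- A section is nonzero if it does not vanish identically. -/
def IsNonzero {L : HolomorphicLineBundle E M} (s : L.HolomorphicSection) : Prop :=
  ∃ i, ∃ x ∈ L.U i, s.f i x ≠ 0

/-- The squared supremum norm `‖s‖²_{φ,∞} = sup_X |s|² e^{-φ}`. -/
def supNormSq {L : HolomorphicLineBundle E M} (s : L.HolomorphicSection) (m : L.SmoothMetric) :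
    ENNReal :=
  ⨆ (i : L.ι) (x : M) (_ : x ∈ L.U i), ENNReal.ofReal (‖s.f i x‖ ^ 2 * Real.exp (-m.φ i x))

end HolomorphicSection

/-- The homogeneous part of degree `d` of the Taylor series of `F` at `q`. -/
def homogeneousPart (F : E → ℂ) (q : E) (d : ℕ) (ξ : E) : ℂ :=
  ((d.factorial : ℂ))⁻¹ * iteratedFDeriv ℂ d F q (fun _ => ξ)

/-- The order of vanishing of `F` at `q`: the least degree of a nonzero homogeneous part of its
Taylor series (and `0` if there is none). -/
def vanishingOrder (F : E → ℂ) (q : E) : ℕ :=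
  sInf {d | ∃ ξ, homogeneousPart F q d ξ ≠ 0}

/-- The leading order homogeneous part of `F` at `q`; it is zero if all Taylor coefficients of `F`
at `q` vanish. -/
def leadingPart (F : E → ℂ) (q : E) (ξ : E) : ℂ :=
  homogeneousPart F q (vanishingOrder F q) ξ

/-- The leading order homogeneous part `s_hom : T_p M → ℂ` of a section at `p`, computed in the
`i`-th trivialization (where `p ∈ U i`) and in the preferred local coordinates at `p`, which are
those in which Mathlib expresses tangent vectors at `p`. -/
def HolomorphicSection.hom {L : HolomorphicLineBundle E M} (s : L.HolomorphicSection)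
    (i : L.ι) (p : M) (ξ : TangentSpace 𝓘(ℂ, E) p) : ℂ :=
  leadingPart (s.f i ∘ (extChartAt 𝓘(ℂ, E) p).symm) (extChartAt 𝓘(ℂ, E) p p) (show E from ξ)

/-- The function `φ_{L,p} = sup^* { k⁻¹ ln |s_hom|² : s ∈ B₁(kL, kφ) ∖ {0}, k ≥ 1 }` on `T_p M`,
where `B₁(kL, kφ)` is the unit ball of the supremum norm on `H⁰(M, kL)` and `*` is the upper
semicontinuous regularization.  It depends on a smooth metric `φ` of `L` and on the choice of a
trivialization `i` near `p`. -/
def canonicalGrowthFunction (L : HolomorphicLineBundle E M) (m : L.SmoothMetric) (p : M)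
    (i : L.ι) (ξ : TangentSpace 𝓘(ℂ, E) p) : EReal :=
  limsup (fun η : TangentSpace 𝓘(ℂ, E) p =>
    ⨆ (k : ℕ) (_ : 1 ≤ k) (s : (L.tensorPower k).HolomorphicSection)
      (_ : s.IsNonzero ∧ s.supNormSq (m.tensorPower k) ≤ 1),
      (((k : ℝ)⁻¹ : ℝ) : EReal) * ENNReal.log (‖s.hom i p η‖ₑ ^ 2)) (𝓝 ξ)

end HolomorphicLineBundle

/-! ### Delzant polytopes -/

/-- The inclusion `ℤⁿ ⊆ ℝⁿ`. -/
def latticeToReal {n : ℕ} (α : Fin n → ℤ) : Fin n → ℝ := fun i => (α i : ℝ)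

/-- A Delzant polytope in `ℝⁿ`: the convex hull of a (nonempty) finite set of integer points such
that near each vertex `v` it coincides with the image of the positive orthant under
`c ↦ v + ∑ cᵢ bᵢ`, for some basis `b` of `ℤⁿ`, i.e. for some element of `GL(n, ℤ)`. -/
structure DelzantPolytope (n : ℕ) where
  carrier : Set (Fin n → ℝ)
  exists_eq_convexHull : ∃ S : Finset (Fin n → ℤ), S.Nonempty ∧
    carrier = convexHull ℝ (latticeToReal '' (S : Set (Fin n → ℤ)))
  delzant : ∀ v ∈ carrier.extremePoints ℝ,
    ∃ b : Module.Basis (Fin n) ℤ (Fin n → ℤ), ∃ N ∈ 𝓝 v, ∀ x ∈ N,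
      (x ∈ carrier ↔ ∃ c : Fin n → ℝ, (∀ i, 0 ≤ c i) ∧ x = v + ∑ i, c i • latticeToReal (b i))

/-- Real linear extensions of the coordinate functions of a lattice basis. -/
lemma exists_realCoord {n : ℕ} (b : Module.Basis (Fin n) ℤ (Fin n → ℤ)) :
    ∃ ρ : Fin n → (Fin n → ℝ) →ₗ[ℝ] ℝ, ∀ i α, ρ i (latticeToReal α) = (b.repr α i : ℝ) := by
  refine ⟨fun i => ∑ j, ((b.repr (Pi.single j 1) i : ℤ) : ℝ) • LinearMap.proj j, fun i α => ?_⟩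
  have h : α = ∑ j, α j • (Pi.single j 1 : Fin n → ℤ) := by
    ext k; simp [Finset.sum_apply, Pi.single_apply]
  conv_rhs => rw [h, map_sum, Finsupp.finsetSum_apply]
  simp only [map_zsmul, Finsupp.smul_apply, LinearMap.sum_apply, LinearMap.smul_apply,
    LinearMap.proj_apply, latticeToReal, smul_eq_mul, Int.cast_sum, Int.cast_mul]
  exact Finset.sum_congr rfl fun j _ => mul_comm _ _

lemma latticeToReal_sub {n : ℕ} (α β : Fin n → ℤ) :
    latticeToReal (α - β) = latticeToReal α - latticeToReal β := by
  ext i; simp [latticeToReal]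

lemma latticeToReal_add {n : ℕ} (α β : Fin n → ℤ) :
    latticeToReal (α + β) = latticeToReal α + latticeToReal β := by
  ext i; simp [latticeToReal]

lemma latticeToReal_injective {n : ℕ} : Function.Injective (latticeToReal (n := n)) := by
  intro α β h
  ext i
  have := congrFun h i
  simpa [latticeToReal] using this

lemma finite_lattice_of_isBounded {n : ℕ} {K : Set (Fin n → ℝ)} (hK : Bornology.IsBounded K) :
    {α : Fin n → ℤ | latticeToReal α ∈ K}.Finite := by
  obtain ⟨R, hR⟩ := hK.subset_closedBall 0
  refine (Set.finite_Icc (fun _ : Fin n => -⌈R⌉) (fun _ => ⌈R⌉)).subset fun α hα => ?_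
  have h1 : ‖latticeToReal α‖ ≤ R := by simpa using hR hα
  have h2 : ∀ i, |(α i : ℝ)| ≤ (⌈R⌉ : ℝ) := fun i =>
    ((norm_le_pi_norm (latticeToReal α) i).trans h1).trans (Int.le_ceil R)
  exact ⟨fun i => by have := (abs_le.1 (h2 i)).1; exact_mod_cast this,
    fun i => by have := (abs_le.1 (h2 i)).2; exact_mod_cast this⟩

namespace DelzantPolytope

variable {n : ℕ} (Δ : DelzantPolytope n)

lemma convex : Convex ℝ Δ.carrier := by
  obtain ⟨S, -, hS⟩ := Δ.exists_eq_convexHull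
  rw [hS]; exact convex_convexHull ℝ _

lemma isCompact : IsCompact Δ.carrier := by
  obtain ⟨S, -, hS⟩ := Δ.exists_eq_convexHull
  rw [hS]; exact Set.Finite.isCompact_convexHull ℝ (S.finite_toSet.image _)

/-- The lattice points `Δ ∩ ℤⁿ`. -/
def LatticePoint : Type := {α : Fin n → ℤ // latticeToReal α ∈ Δ.carrier}

/-- The vertices of `Δ` (these are lattice points). -/
def Vertex : Type := {v : Fin n → ℤ // latticeToReal v ∈ Δ.carrier.extremePoints ℝ}

instance : Finite Δ.LatticePoint :=
  (finite_lattice_of_isBounded Δ.isCompact.isBounded).to_subtype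

instance : Fintype Δ.LatticePoint := Fintype.ofFinite _

instance : Nonempty Δ.LatticePoint := by
  obtain ⟨S, ⟨α, hα⟩, hS⟩ := Δ.exists_eq_convexHull
  exact ⟨⟨α, hS ▸ subset_convexHull ℝ _ ⟨α, hα, rfl⟩⟩⟩

variable {Δ}

/-- A vertex as a lattice point. -/
def Vertex.toLatticePoint (v : Δ.Vertex) : Δ.LatticePoint := ⟨v.1, v.2.1⟩

lemma exists_vertex_eq {x : Fin n → ℝ} (hx : x ∈ Δ.carrier.extremePoints ℝ) :
    ∃ v : Δ.Vertex, latticeToReal v.1 = x := by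
  obtain ⟨S, -, hS⟩ := Δ.exists_eq_convexHull
  obtain ⟨α, -, rfl⟩ := extremePoints_convexHull_subset (hS ▸ hx)
  exact ⟨⟨α, hx⟩, rfl⟩

instance : Finite Δ.Vertex :=
  Finite.of_injective Vertex.toLatticePoint fun _ _ h =>
    Subtype.ext (congrArg (fun a : Δ.LatticePoint => a.1) h)

/-- A linear functional attains its maximum over `Δ` at a vertex. -/
lemma exists_vertex_max (l : (Fin n → ℝ) →L[ℝ] ℝ) :
    ∃ v : Δ.Vertex, ∀ x ∈ Δ.carrier, l x ≤ l (latticeToReal v.1) := by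
  have hne : Δ.carrier.Nonempty := ⟨_, (Classical.arbitrary Δ.LatticePoint).2⟩
  have hexp : IsExposed ℝ Δ.carrier (l.toExposed Δ.carrier) :=
    ContinuousLinearMap.toExposed.isExposed
  obtain ⟨y, hy, hmax⟩ := Δ.isCompact.exists_isMaxOn hne l.continuous.continuousOn
  obtain ⟨x, hx⟩ := (hexp.isCompact Δ.isCompact).extremePoints_nonempty ⟨y, hy, fun z hz => hmax hz⟩
  obtain ⟨v, hv⟩ := exists_vertex_eq (hexp.isExtreme.extremePoints_subset_extremePoints hx)
  exact ⟨v, fun z hz => hv ▸ hx.1.2 z hz⟩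

namespace Vertex

/-- The primitive generators of the edges of `Δ` emanating from the vertex `v`; they form a basis of
`ℤⁿ`, unique up to the ordering of its elements. -/
def edgeBasis (v : Δ.Vertex) : Module.Basis (Fin n) ℤ (Fin n → ℤ) :=
  (Δ.delzant _ v.2).choose

lemma edgeBasis_spec (v : Δ.Vertex) : ∃ N ∈ 𝓝 (latticeToReal v.1), ∀ x ∈ N,
    (x ∈ Δ.carrier ↔ ∃ c : Fin n → ℝ, (∀ i, 0 ≤ c i) ∧
      x = latticeToReal v.1 + ∑ i, c i • latticeToReal (v.edgeBasis i)) :=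
  (Δ.delzant _ v.2).choose_spec

lemma exists_cone_coord (v : Δ.Vertex) {x : Fin n → ℝ} (hx : x ∈ Δ.carrier) :
    ∃ c : Fin n → ℝ, (∀ i, 0 ≤ c i) ∧
      x = latticeToReal v.1 + ∑ i, c i • latticeToReal (v.edgeBasis i) := by
  obtain ⟨N, hN, h⟩ := v.edgeBasis_spec
  have hlim : Tendsto (fun t : ℝ => latticeToReal v.1 + t • (x - latticeToReal v.1)) (𝓝[>] 0)
      (𝓝 (latticeToReal v.1)) := by
    have : Continuous fun t : ℝ => latticeToReal v.1 + t • (x - latticeToReal v.1) := by fun_prop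
    simpa using (this.tendsto 0).mono_left nhdsWithin_le_nhds
  have h1 : ∀ᶠ t : ℝ in 𝓝[>] 0, t < 1 := nhdsWithin_le_nhds (gt_mem_nhds one_pos)
  obtain ⟨t, ⟨htN, ht1⟩, ht0⟩ :=
    ((hlim.eventually hN).and h1 |>.and self_mem_nhdsWithin).exists
  have ht0 : 0 < t := ht0
  obtain ⟨c, hc, hcx⟩ := (h _ htN).1 (Δ.convex.add_smul_sub_mem v.2.1 hx ⟨ht0.le, ht1.le⟩)
  refine ⟨fun i => t⁻¹ * c i, fun i => mul_nonneg (inv_nonneg.2 ht0.le) (hc i), ?_⟩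
  have hcx' := add_left_cancel hcx
  simp_rw [mul_smul]
  rw [← Finset.smul_sum, ← hcx', smul_smul, inv_mul_cancel₀ ht0.ne', one_smul]
  abel

lemma realCoord_eq {b : Module.Basis (Fin n) ℤ (Fin n → ℤ)} {ρ : Fin n → (Fin n → ℝ) →ₗ[ℝ] ℝ}
    (hρ : ∀ i α, ρ i (latticeToReal α) = (b.repr α i : ℝ)) (c : Fin n → ℝ) (i : Fin n) :
    ρ i (∑ j, c j • latticeToReal (b j)) = c i := by
  simp [map_sum, hρ, Finsupp.single_apply]

lemma repr_nonneg (v : Δ.Vertex) (α : Δ.LatticePoint) (i : Fin n) :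
    0 ≤ v.edgeBasis.repr (α.1 - v.1) i := by
  obtain ⟨ρ, hρ⟩ := exists_realCoord v.edgeBasis
  obtain ⟨c, hc, hcx⟩ := v.exists_cone_coord α.2
  have h : ρ i (latticeToReal (α.1 - v.1)) = c i := by
    rw [latticeToReal_sub, hcx, add_sub_cancel_left, realCoord_eq hρ]
  rw [hρ] at h
  exact_mod_cast h ▸ hc i

lemma add_edge_mem (v : Δ.Vertex) (i : Fin n) :
    latticeToReal (v.1 + v.edgeBasis i) ∈ Δ.carrier := by
  obtain ⟨ρ, hρ⟩ := exists_realCoord v.edgeBasis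
  obtain ⟨S, -, hS⟩ := Δ.exists_eq_convexHull
  obtain ⟨N, hN, h⟩ := v.edgeBasis_spec
  have hlim : Tendsto (fun t : ℝ => latticeToReal v.1 + t • latticeToReal (v.edgeBasis i)) (𝓝[>] 0)
      (𝓝 (latticeToReal v.1)) := by
    have : Continuous fun t : ℝ => latticeToReal v.1 + t • latticeToReal (v.edgeBasis i) := by
      fun_prop
    simpa using (this.tendsto 0).mono_left nhdsWithin_le_nhds
  obtain ⟨t, htN, ht0⟩ := ((hlim.eventually hN).and self_mem_nhdsWithin).exists
  have ht0 : 0 < t := ht0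
  have hmem : latticeToReal v.1 + t • latticeToReal (v.edgeBasis i) ∈ Δ.carrier := by
    refine (h _ htN).2 ⟨Pi.single i t, fun j => ?_, ?_⟩
    · by_cases hj : j = i
      · subst hj; simpa using ht0.le
      · simp [hj]
    · congr 1
      rw [Finset.sum_eq_single i] <;> simp +contextual
  have hmem' : latticeToReal v.1 + t • latticeToReal (v.edgeBasis i) ∈
      convexHull ℝ ((S.image latticeToReal : Finset (Fin n → ℝ)) : Set (Fin n → ℝ)) := by
    rw [Finset.coe_image]; exact hS.subset hmem
  obtain ⟨wt, hw0, hw1, hwx⟩ := Finset.mem_convexHull.1 hmem'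
  rw [Finset.centerMass_eq_of_sum_1 _ _ hw1] at hwx
  have hpos : ∀ y ∈ S.image latticeToReal, ∀ j, 0 ≤ ρ j (y - latticeToReal v.1) := by
    intro y hy j
    obtain ⟨c, hc, hcx⟩ := v.exists_cone_coord (x := y)
      (hS.symm.subset (subset_convexHull ℝ _ (by rw [← Finset.coe_image]; exact hy)))
    rw [hcx, add_sub_cancel_left, realCoord_eq hρ]
    exact hc j
  have hsum : ∀ j, ∑ y ∈ S.image latticeToReal, wt y * ρ j (y - latticeToReal v.1) =
      if j = i then t else 0 := by
    intro j
    have h1 := congrArg (ρ j) hwx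
    simp only [map_sum, map_smul, map_add, id, hρ, smul_eq_mul] at h1
    simp only [map_sub, mul_sub, Finset.sum_sub_distrib, ← Finset.sum_mul, hw1, one_mul, hρ]
    rw [h1]
    by_cases hj : j = i
    · subst hj; simp
    · simp [hj]
  have hi : 0 < ∑ y ∈ S.image latticeToReal, wt y * ρ i (y - latticeToReal v.1) := by
    rw [hsum]; simpa using ht0
  obtain ⟨y, hy, hypos⟩ : ∃ y ∈ S.image latticeToReal, 0 < wt y * ρ i (y - latticeToReal v.1) := by
    by_contra! hcon
    exact absurd hi (not_lt.2 (Finset.sum_nonpos hcon))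
  have hwy : 0 < wt y := (hw0 y hy).lt_of_ne fun h0 => by simp [← h0] at hypos
  have hyi : 0 < ρ i (y - latticeToReal v.1) := pos_of_mul_pos_right hypos hwy.le
  have hyj : ∀ j, j ≠ i → ρ j (y - latticeToReal v.1) = 0 := by
    intro j hj
    have h1 := hsum j
    rw [if_neg hj, Finset.sum_eq_zero_iff_of_nonneg
      (fun y hy => mul_nonneg (hw0 y hy) (hpos y hy j))] at h1
    exact (mul_eq_zero.1 (h1 y hy)).resolve_left hwy.ne'
  have hyΔ : y ∈ Δ.carrier :=
    hS.symm.subset (subset_convexHull ℝ _ (by rw [← Finset.coe_image]; exact hy))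
  obtain ⟨s, -, rfl⟩ := Finset.mem_image.1 hy
  rw [← latticeToReal_sub, hρ] at hyi
  simp only [← latticeToReal_sub, hρ] at hyj
  set m : ℤ := v.edgeBasis.repr (s - v.1) i with hm
  have hm1 : (1 : ℝ) ≤ m := by
    have : 0 < m := by exact_mod_cast hyi
    exact_mod_cast this
  have hs : s - v.1 = m • v.edgeBasis i := by
    apply v.edgeBasis.repr.injective
    ext j
    rw [map_zsmul, Finsupp.smul_apply, Module.Basis.repr_self, Finsupp.single_apply]
    by_cases hj : j = i
    · subst hj; rw [if_pos rfl, hm]; simp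
    · have := hyj j hj
      simp only [Int.cast_eq_zero] at this
      rw [this, if_neg (Ne.symm hj), smul_zero]
  have hkey : latticeToReal (v.1 + v.edgeBasis i) =
      latticeToReal v.1 + (m : ℝ)⁻¹ • (latticeToReal s - latticeToReal v.1) := by
    rw [← latticeToReal_sub, hs, latticeToReal_add]
    congr 1
    ext j
    have : (m : ℝ) ≠ 0 := by positivity
    simp [latticeToReal, this]
  rw [hkey]
  exact Δ.convex.add_smul_sub_mem v.2.1 hyΔ ⟨by positivity, inv_le_one_of_one_le₀ hm1⟩

/-- The exponents of the monomial in the affine coordinates at `v` that corresponds to the lattice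
point `α`: the coordinates of `α - v` in the edge basis, which are nonnegative. -/
def exponent (v : Δ.Vertex) (α : Δ.LatticePoint) (i : Fin n) : ℕ :=
  (v.edgeBasis.repr (α.1 - v.1) i).toNat

lemma exponent_cast (v : Δ.Vertex) (α : Δ.LatticePoint) (i : Fin n) :
    ((v.exponent α i : ℕ) : ℤ) = v.edgeBasis.repr (α.1 - v.1) i :=
  Int.toNat_of_nonneg (v.repr_nonneg α i)

lemma exponent_self (v : Δ.Vertex) (i : Fin n) : v.exponent v.toLatticePoint i = 0 := by
  simp [exponent, toLatticePoint]

/-- The lattice point next to `v` on its `i`-th edge. -/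
def neighbor (v : Δ.Vertex) (i : Fin n) : Δ.LatticePoint := ⟨v.1 + v.edgeBasis i, v.add_edge_mem i⟩

lemma exponent_neighbor (v : Δ.Vertex) (i j : Fin n) :
    v.exponent (v.neighbor i) j = if i = j then 1 else 0 := by
  simp only [exponent, neighbor, add_sub_cancel_left, Module.Basis.repr_self,
    Finsupp.single_apply]
  split_ifs <;> rfl

/-- All the monomials `z^(α - v)`, `α ∈ Δ ∩ ℤⁿ`, in the affine coordinates at `v`. -/
def monomials (v : Δ.Vertex) (z : Fin n → ℂ) (α : Δ.LatticePoint) : ℂ :=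
  ∏ i, z i ^ v.exponent α i

lemma monomials_self (v : Δ.Vertex) (z : Fin n → ℂ) : v.monomials z v.toLatticePoint = 1 := by
  simp [monomials, exponent_self]

lemma monomials_neighbor (v : Δ.Vertex) (z : Fin n → ℂ) (i : Fin n) :
    v.monomials z (v.neighbor i) = z i := by
  simp [monomials, exponent_neighbor]

lemma monomials_ne_zero (v : Δ.Vertex) (z : Fin n → ℂ) : v.monomials z ≠ 0 := fun h => by
  have := congrFun h v.toLatticePoint
  rw [monomials_self] at this
  exact one_ne_zero this

lemma contDiff_monomials (v : Δ.Vertex) (α : Δ.LatticePoint) :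
    ContDiff ℂ ω fun z => v.monomials z α := by
  unfold monomials
  fun_prop

end Vertex

end DelzantPolytope

/-! ### Complex projective space as a topological space -/

/-- The topology of `ℙ^N` is the quotient topology. -/
instance projectivizationTopologicalSpace {ι : Type*} : TopologicalSpace (ℙ ℂ (ι → ℂ)) :=
  TopologicalSpace.coinduced (Projectivization.mk' ℂ) inferInstance

lemma isQuotientMap_mk' {ι : Type*} :
    IsQuotientMap (Projectivization.mk' ℂ : {x : ι → ℂ // x ≠ 0} → ℙ ℂ (ι → ℂ)) :=
  ⟨⟨rfl⟩, fun p => ⟨⟨p.rep, p.rep_nonzero⟩, p.mk_rep⟩⟩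

lemma exists_rep_mk' {ι : Type*} (x : {x : ι → ℂ // x ≠ 0}) :
    ∃ a : ℂ, a ≠ 0 ∧ ∀ i, (Projectivization.mk' ℂ x).rep i = a * x.1 i := by
  obtain ⟨a, ha⟩ := Projectivization.exists_smul_eq_mk_rep ℂ x.1 x.2
  exact ⟨a, a.ne_zero, fun i => (congrFun ha i).symm⟩

lemma continuous_coord {ι : Type*} (i : ι) :
    Continuous fun x : {x : ι → ℂ // x ≠ 0} => x.1 i :=
  (continuous_apply i).comp continuous_subtype_val

lemma isOpen_coord_ne_zero {ι : Type*} (i : ι) : IsOpen {p : ℙ ℂ (ι → ℂ) | p.rep i ≠ 0} := by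
  rw [← isQuotientMap_mk'.isOpen_preimage]
  have : (Projectivization.mk' ℂ ⁻¹' {p : ℙ ℂ (ι → ℂ) | p.rep i ≠ 0}) =
      {x : {x : ι → ℂ // x ≠ 0} | x.1 i ≠ 0} := by
    ext x
    obtain ⟨a, ha, hx⟩ := exists_rep_mk' x
    simp [-Projectivization.mk'_eq_mk, hx, ha]
  rw [this]
  exact isOpen_ne_fun (continuous_coord i) continuous_const

lemma continuousOn_coord_ratio {ι : Type*} (i j : ι) :
    ContinuousOn (fun p : ℙ ℂ (ι → ℂ) => p.rep j / p.rep i) {p | p.rep i ≠ 0} := by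
  refine (isQuotientMap_mk'.continuousOn_isOpen_iff (isOpen_coord_ne_zero i)).2 ?_
  have : ((fun p : ℙ ℂ (ι → ℂ) => p.rep j / p.rep i) ∘ Projectivization.mk' ℂ) =
      fun x : {x : ι → ℂ // x ≠ 0} => x.1 j / x.1 i := by
    ext x
    obtain ⟨a, ha, hx⟩ := exists_rep_mk' x
    simp [-Projectivization.mk'_eq_mk, hx, mul_div_mul_left _ _ ha]
  rw [this]
  refine ContinuousOn.div (continuous_coord j).continuousOn
    (continuous_coord i).continuousOn fun x hx => ?_
  obtain ⟨a, ha, hx'⟩ := exists_rep_mk' x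
  simpa [-Projectivization.mk'_eq_mk, hx', ha] using hx

namespace DelzantPolytope

variable {n : ℕ} (Δ : DelzantPolytope n)

/-! ### The toric manifold `X_Δ` -/

/-- The monomials `t^α`, `α ∈ Δ ∩ ℤⁿ`, of a point `t` of the torus `(ℂ^*)ⁿ`. -/
def torusMonomials (t : Fin n → ℂˣ) (α : Δ.LatticePoint) : ℂ :=
  ((∏ i, t i ^ α.1 i : ℂˣ) : ℂ)

lemma torusMonomials_ne_zero (t : Fin n → ℂˣ) : Δ.torusMonomials t ≠ 0 := fun h =>
  Units.ne_zero _ (congrFun h (Classical.arbitrary Δ.LatticePoint))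

/-- The map `(ℂ^*)ⁿ → ℙ^N`, `t ↦ [t^α : α ∈ Δ ∩ ℤⁿ]`, which embeds the torus. -/
def torusPoint (t : Fin n → ℂˣ) : ℙ ℂ (Δ.LatticePoint → ℂ) :=
  Projectivization.mk ℂ (Δ.torusMonomials t) (Δ.torusMonomials_ne_zero t)

/-- The toric manifold `X_Δ`: the closure of the torus `{[t^α : α ∈ Δ ∩ ℤⁿ] : t ∈ (ℂ^*)ⁿ}` in
projective space. -/
def ToricManifold : Type :=
  closure (Set.range Δ.torusPoint)

variable {Δ}

/-- The homogeneous coordinates (up to a common factor) of a point of `X_Δ ⊆ ℙ^N`. -/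
def ToricManifold.coord (p : Δ.ToricManifold) : Δ.LatticePoint → ℂ := p.1.rep

instance : TopologicalSpace Δ.ToricManifold :=
  inferInstanceAs (TopologicalSpace (closure (Set.range Δ.torusPoint)))

lemma zpow_finset_sum {G : Type*} [CommGroup G] (a : G) (f : Fin n → ℤ) :
    a ^ (∑ i, f i) = ∏ i, a ^ f i := by
  generalize (Finset.univ : Finset (Fin n)) = s
  induction s using Finset.induction_on with
  | empty => simp
  | insert i s hi ih => rw [Finset.sum_insert hi, Finset.prod_insert hi, zpow_add, ih]

lemma torusMonomials_eq (v : Δ.Vertex) (t : Fin n → ℂˣ) (α : Δ.LatticePoint) :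
    Δ.torusMonomials t α = Δ.torusMonomials t v.toLatticePoint *
      ∏ i, ((∏ j, t j ^ v.edgeBasis i j : ℂˣ) : ℂ) ^ v.exponent α i := by
  have hα : ∀ j, α.1 j = v.1 j + ∑ i, v.edgeBasis i j * (v.exponent α i : ℤ) := by
    intro j
    have h := congrFun (v.edgeBasis.sum_repr (α.1 - v.1)) j
    simp only [Finset.sum_apply, Pi.smul_apply, smul_eq_mul, Pi.sub_apply] at h
    simp_rw [Vertex.exponent_cast, mul_comm (v.edgeBasis _ j)]
    rw [h]; ring
  have h : (∏ j, t j ^ α.1 j) = (∏ j, t j ^ v.1 j) *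
      ∏ i, (∏ j, t j ^ v.edgeBasis i j) ^ v.exponent α i := by
    simp_rw [← Finset.prod_pow]
    rw [Finset.prod_comm, ← Finset.prod_mul_distrib]
    refine Finset.prod_congr rfl fun j _ => ?_
    rw [hα j, zpow_add, zpow_finset_sum]
    simp only [zpow_mul, zpow_natCast]
  have := congrArg (Units.val) h
  simpa [torusMonomials, Vertex.toLatticePoint] using this

lemma coord_relation (p : Δ.ToricManifold) (v : Δ.Vertex) (α : Δ.LatticePoint) :
    p.coord α * p.coord v.toLatticePoint ^ (∑ i, v.exponent α i) =
      p.coord v.toLatticePoint * ∏ i, p.coord (v.neighbor i) ^ v.exponent α i := by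
  set F : (Δ.LatticePoint → ℂ) → ℂ := fun x =>
    x α * x v.toLatticePoint ^ (∑ i, v.exponent α i) -
      x v.toLatticePoint * ∏ i, x (v.neighbor i) ^ v.exponent α i with hF
  have hhom : ∀ (a : ℂ) (x y : Δ.LatticePoint → ℂ), (∀ β, y β = a * x β) →
      F y = a ^ (1 + ∑ i, v.exponent α i) * F x := by
    intro a x y h
    simp only [hF, h, mul_pow, Finset.prod_mul_distrib, Finset.prod_pow_eq_pow_sum, pow_add,
      pow_one]
    ring
  have hclosed : IsClosed {q : ℙ ℂ (Δ.LatticePoint → ℂ) | F q.rep = 0} := by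
    rw [← isQuotientMap_mk'.isClosed_preimage]
    have : (Projectivization.mk' ℂ ⁻¹' {q : ℙ ℂ (Δ.LatticePoint → ℂ) | F q.rep = 0}) =
        {x : {x : Δ.LatticePoint → ℂ // x ≠ 0} | F x.1 = 0} := by
      ext x
      obtain ⟨a, ha, hx⟩ := exists_rep_mk' x
      simp [-Projectivization.mk'_eq_mk, hhom a _ _ hx, ha]
    rw [this]
    have hcont : Continuous F := by fun_prop
    exact isClosed_eq (hcont.comp continuous_subtype_val) continuous_const
  have hsub : closure (Set.range Δ.torusPoint) ⊆ {q | F q.rep = 0} := by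
    refine closure_minimal ?_ hclosed
    rintro _ ⟨t, rfl⟩
    obtain ⟨a, ha, hx⟩ := exists_rep_mk' ⟨_, Δ.torusMonomials_ne_zero t⟩
    have h0 : F (Δ.torusMonomials t) = 0 := by
      simp only [hF]
      rw [torusMonomials_eq v t α]
      simp_rw [torusMonomials_eq v t (v.neighbor _), Vertex.exponent_neighbor]
      simp only [pow_ite, pow_one, pow_zero, Finset.prod_ite_eq, Finset.mem_univ, if_true, mul_pow,
        Finset.prod_mul_distrib, Finset.prod_pow_eq_pow_sum]
      ring
    have := hhom a _ _ hx
    rw [h0, mul_zero] at this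
    exact this
  exact sub_eq_zero.1 (hsub p.2)

lemma exists_coord_ne_zero (p : Δ.ToricManifold) : ∃ v : Δ.Vertex, p.coord v.toLatticePoint ≠ 0 := by
  set K : Δ.Vertex → Set (ℙ ℂ (Δ.LatticePoint → ℂ)) := fun v =>
    {q | ∀ α, ‖q.rep α‖ ≤ ‖q.rep v.toLatticePoint‖}
  have hclosed : IsClosed (⋃ v, K v) := by
    refine isClosed_iUnion_of_finite fun v => ?_
    rw [← isQuotientMap_mk'.isClosed_preimage]
    have : (Projectivization.mk' ℂ ⁻¹' K v) =
        {x : {x : Δ.LatticePoint → ℂ // x ≠ 0} | ∀ α, ‖x.1 α‖ ≤ ‖x.1 v.toLatticePoint‖} := by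
      ext x
      obtain ⟨a, ha, hx⟩ := exists_rep_mk' x
      simp [-Projectivization.mk'_eq_mk, K, hx, ha]
    rw [this, Set.ofPred_forall]
    exact isClosed_iInter fun α => isClosed_le (continuous_coord α).norm
      (continuous_coord v.toLatticePoint).norm
  have hsub : closure (Set.range Δ.torusPoint) ⊆ ⋃ v, K v := by
    refine closure_minimal ?_ hclosed
    rintro _ ⟨t, rfl⟩
    obtain ⟨a, ha, hx⟩ := exists_rep_mk' ⟨_, Δ.torusMonomials_ne_zero t⟩
    obtain ⟨v, hv⟩ := exists_vertex_max (Δ := Δ)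
      (∑ i, Real.log ‖(t i : ℂ)‖ • ContinuousLinearMap.proj (R := ℝ) (φ := fun _ : Fin n => ℝ) i)
    have hnorm : ∀ α : Δ.LatticePoint, ‖Δ.torusMonomials t α‖ =
        Real.exp (∑ i, Real.log ‖(t i : ℂ)‖ * latticeToReal α.1 i) := by
      intro α
      rw [Real.exp_sum]
      simp only [torusMonomials, Units.coe_prod, Units.val_zpow_eq_zpow_val, norm_prod, norm_zpow,
        latticeToReal]
      refine Finset.prod_congr rfl fun i _ => ?_
      rw [← Real.rpow_def_of_pos (norm_pos_iff.2 (t i).ne_zero), Real.rpow_intCast]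
    refine Set.mem_iUnion.2 ⟨v, fun α => ?_⟩
    have h1 := hv _ α.2
    simp only [sum_apply, smul_apply,
      ContinuousLinearMap.proj_apply, smul_eq_mul] at h1
    change ‖(Projectivization.mk' ℂ ⟨_, Δ.torusMonomials_ne_zero t⟩).rep α‖ ≤
      ‖(Projectivization.mk' ℂ ⟨_, Δ.torusMonomials_ne_zero t⟩).rep v.toLatticePoint‖
    rw [hx, hx, norm_mul, norm_mul, hnorm, hnorm]
    exact mul_le_mul_of_nonneg_left (Real.exp_le_exp.2 h1) (norm_nonneg a)
  obtain ⟨v, hv⟩ := Set.mem_iUnion.1 (hsub p.2)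
  refine ⟨v, fun h0 => p.1.rep_nonzero (funext fun α => ?_)⟩
  have := hv α
  change p.1.rep v.toLatticePoint = 0 at h0
  rw [h0, norm_zero] at this
  exact norm_le_zero_iff.1 this

namespace Vertex

variable (v : Δ.Vertex)

/-- The map `ℂⁿ → ℙ^N`, `z ↦ [z^(α - v) : α ∈ Δ ∩ ℤⁿ]`. -/
def affinePoint (z : Fin n → ℂ) : ℙ ℂ (Δ.LatticePoint → ℂ) :=
  Projectivization.mk' ℂ ⟨v.monomials z, v.monomials_ne_zero z⟩

lemma continuous_affinePoint : Continuous v.affinePoint := by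
  refine isQuotientMap_mk'.continuous.comp (Continuous.subtype_mk ?_ _)
  exact continuous_pi fun α => (v.contDiff_monomials α).continuous

lemma affinePoint_mem (z : Fin n → ℂ) : v.affinePoint z ∈ closure (Set.range Δ.torusPoint) := by
  have hdense : Dense {z : Fin n → ℂ | ∀ i, z i ≠ 0} := by
    have := dense_pi (Set.univ : Set (Fin n)) (s := fun _ => ({0}ᶜ : Set ℂ))
      (fun i _ => dense_compl_singleton 0)
    convert this using 1
    ext z; simp
  have hsub : v.affinePoint '' {z : Fin n → ℂ | ∀ i, z i ≠ 0} ⊆ Set.range Δ.torusPoint := by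
    rintro _ ⟨z, hz, rfl⟩
    let u : Fin n → ℂˣ := fun i => Units.mk0 (z i) (hz i)
    let t : Fin n → ℂˣ := fun j => ∏ i, u i ^ v.edgeBasis.repr (Pi.single j 1) i
    have ht : ∀ β : Fin n → ℤ, (∏ j, t j ^ β j) = ∏ i, u i ^ v.edgeBasis.repr β i := by
      intro β
      simp only [t, ← Finset.prod_zpow]
      rw [Finset.prod_comm]
      refine Finset.prod_congr rfl fun i _ => ?_
      have hβ : β = ∑ j, β j • (Pi.single j 1 : Fin n → ℤ) := by
        ext k; simp [Finset.sum_apply, Pi.single_apply]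
      conv_rhs => rw [hβ, map_sum, Finsupp.finsetSum_apply,
        zpow_finset_sum]
      refine Finset.prod_congr rfl fun j _ => ?_
      rw [map_zsmul, Finsupp.smul_apply, smul_eq_mul, mul_comm, zpow_mul]
    refine ⟨t, ?_⟩
    refine (Projectivization.mk_eq_mk_iff' ℂ _ _ _ _).2
      ⟨Δ.torusMonomials t v.toLatticePoint, funext fun α => ?_⟩
    have h1 : α.1 = v.1 + (α.1 - v.1) := by abel
    simp only [torusMonomials, Pi.smul_apply, smul_eq_mul, ht, toLatticePoint, monomials]
    rw [h1, map_add]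
    simp only [Finsupp.add_apply, zpow_add, Finset.prod_mul_distrib, Units.val_mul]
    congr 1
    simp only [Units.coe_prod, ← exponent_cast, zpow_natCast, Units.val_pow_eq_pow_val]
    rfl
  have := (image_closure_subset_closure_image v.continuous_affinePoint).trans (closure_mono hsub)
  exact this ⟨z, hdense z, rfl⟩

/-- The affine chart at `v`: its domain is `{x_v ≠ 0}`, its coordinates are the ratios
`x_{v + bᵢ} / x_v` (`b` the edge basis at `v`), and its inverse is the embedding
`ℂⁿ ⊆ X_Δ`, `z ↦ [z^(α - v) : α ∈ Δ ∩ ℤⁿ]`. -/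
def chart : OpenPartialHomeomorph Δ.ToricManifold (Fin n → ℂ) where
  toFun p i := p.coord (v.neighbor i) / p.coord v.toLatticePoint
  invFun z := ⟨v.affinePoint z, v.affinePoint_mem z⟩
  source := {p | p.coord v.toLatticePoint ≠ 0}
  target := Set.univ
  map_source' _ _ := Set.mem_univ _
  map_target' z _ := by
    obtain ⟨a, ha, h⟩ := exists_rep_mk' ⟨v.monomials z, v.monomials_ne_zero z⟩
    change (v.affinePoint z).rep v.toLatticePoint ≠ 0
    rw [affinePoint, h]
    change a * v.monomials z v.toLatticePoint ≠ 0
    rwa [monomials_self, mul_one]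
  left_inv' p hp := by
    have hp : p.coord v.toLatticePoint ≠ 0 := hp
    refine Subtype.ext ?_
    rw [← p.1.mk_rep]
    refine (Projectivization.mk_eq_mk_iff' ℂ _ _ _ _).2
      ⟨(p.coord v.toLatticePoint)⁻¹, funext fun α => ?_⟩
    have := coord_relation p v α
    simp only [Pi.smul_apply, smul_eq_mul, monomials, div_pow, Finset.prod_div_distrib,
      Finset.prod_pow_eq_pow_sum]
    rw [eq_div_iff (pow_ne_zero _ hp), mul_assoc]
    change _ * (p.coord α * _) = _
    rw [this, inv_mul_cancel_left₀ hp]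
  right_inv' z _ := by
    obtain ⟨a, ha, h⟩ := exists_rep_mk' ⟨v.monomials z, v.monomials_ne_zero z⟩
    funext i
    change (v.affinePoint z).rep (v.neighbor i) / (v.affinePoint z).rep v.toLatticePoint = z i
    rw [affinePoint, h, h]
    change a * v.monomials z (v.neighbor i) / (a * v.monomials z v.toLatticePoint) = z i
    rw [monomials_self, monomials_neighbor, mul_one, mul_div_cancel_left₀ _ ha]
  open_source := (isOpen_coord_ne_zero v.toLatticePoint).preimage continuous_subtype_val
  open_target := isOpen_univ
  continuousOn_toFun := continuousOn_pi.2 fun i =>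
    (continuousOn_coord_ratio v.toLatticePoint (v.neighbor i)).comp
      continuous_subtype_val.continuousOn fun _ hp => hp
  continuousOn_invFun := (v.continuous_affinePoint.subtype_mk _).continuousOn

lemma coord_chart_symm (z : Fin n → ℂ) : ∃ a : ℂ, a ≠ 0 ∧
    ∀ α, ToricManifold.coord (v.chart.symm z) α = a * v.monomials z α :=
  exists_rep_mk' ⟨v.monomials z, v.monomials_ne_zero z⟩

/-- The point of `X_Δ` corresponding to the vertex `v`: the origin of the affine chart at `v`. -/
def point : Δ.ToricManifold := v.chart.symm 0

end Vertex

/-- `X_Δ` is covered by the affine charts at the vertices of `Δ`. -/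
instance : ChartedSpace (Fin n → ℂ) Δ.ToricManifold where
  atlas := Set.range Vertex.chart
  chartAt p := (exists_coord_ne_zero p).choose.chart
  mem_chart_source p := (exists_coord_ne_zero p).choose_spec
  chart_mem_atlas _ := Set.mem_range_self _

/-- `X_Δ` is a complex manifold. -/
instance : IsManifold 𝓘(ℂ, Fin n → ℂ) ω Δ.ToricManifold := by
  refine isManifold_of_contDiffOn _ _ _ ?_
  rintro _ _ ⟨v, rfl⟩ ⟨w, rfl⟩
  have hfun : ∀ z : Fin n → ℂ, w.chart (v.chart.symm z) = fun i =>
      v.monomials z (w.neighbor i) / v.monomials z w.toLatticePoint := by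
    intro z
    obtain ⟨a, ha, h⟩ := v.coord_chart_symm z
    funext i
    change ToricManifold.coord (v.chart.symm z) (w.neighbor i) /
      ToricManifold.coord (v.chart.symm z) w.toLatticePoint = _
    rw [h, h, mul_div_mul_left _ _ ha]
  have hmain : ContDiffOn ℂ ω (fun (z : Fin n → ℂ) i =>
      v.monomials z (w.neighbor i) / v.monomials z w.toLatticePoint)
      {z | v.monomials z w.toLatticePoint ≠ 0} :=
    contDiffOn_pi.2 fun i => (v.contDiff_monomials _).contDiffOn.div
      (v.contDiff_monomials _).contDiffOn fun z hz => hz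
  refine (hmain.congr fun z hz => hfun z).mono ?_
  intro z hz
  obtain ⟨a, ha, h⟩ := v.coord_chart_symm z
  have h2 : ToricManifold.coord (v.chart.symm z) w.toLatticePoint ≠ 0 := hz.1.2
  rw [h] at h2
  exact right_ne_zero_of_mul h2

/-! ### The line bundle `L_Δ` -/

lemma mdifferentiableOn_coord_ratio (v w : Δ.Vertex) :
    MDifferentiableOn 𝓘(ℂ, Fin n → ℂ) 𝓘(ℂ, ℂ)
      (fun p : Δ.ToricManifold => p.coord w.toLatticePoint / p.coord v.toLatticePoint)
      {p | p.coord v.toLatticePoint ≠ 0} := by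
  have h1 : MDifferentiableOn 𝓘(ℂ, Fin n → ℂ) 𝓘(ℂ, Fin n → ℂ) v.chart v.chart.source :=
    mdifferentiableOn_atlas (Set.mem_range_self v)
  have h2 : MDifferentiable 𝓘(ℂ, Fin n → ℂ) 𝓘(ℂ, ℂ) fun z => v.monomials z w.toLatticePoint :=
    ((v.contDiff_monomials w.toLatticePoint).differentiable (by simp)).mdifferentiable
  refine (h2.comp_mdifferentiableOn h1).congr fun p hp => ?_
  obtain ⟨a, ha, h⟩ := v.coord_chart_symm (v.chart p)
  rw [v.chart.left_inv hp] at h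
  rw [h, h, Vertex.monomials_self, mul_one, mul_div_cancel_left₀ _ ha]
  rfl

variable (Δ) in
/-- The line bundle `L_Δ`, i.e. the restriction of `𝒪(1)` to `X_Δ ⊆ ℙ^N`.  It is trivialized over
`{x_v ≠ 0}` by the section `x_v`, for each vertex `v`, so the transition functions are
`x_w / x_v`. -/
def lineBundle : HolomorphicLineBundle (Fin n → ℂ) Δ.ToricManifold where
  ι := Δ.Vertex
  U v := {p | p.coord v.toLatticePoint ≠ 0}
  isOpen_U v := v.chart.open_source
  cover := exists_coord_ne_zero
  g v w p := p.coord w.toLatticePoint / p.coord v.toLatticePoint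
  g_ne_zero _ _ _ hp := div_ne_zero hp.2 hp.1
  g_holomorphic v w := (mdifferentiableOn_coord_ratio v w).mono Set.inter_subset_left
  g_cocycle u v w p hp := by
    have := hp.1.2
    rw [mul_comm]
    exact div_mul_div_cancel₀ this

/-! ### The torus action and the toric growth function -/

/-- The action of `t ∈ (ℂ^*)ⁿ` on homogeneous coordinates, `x_α ↦ t^α x_α`. -/
def torusLinearMap (t : Fin n → ℂˣ) : (Δ.LatticePoint → ℂ) →ₗ[ℂ] (Δ.LatticePoint → ℂ) where
  toFun x α := Δ.torusMonomials t α * x α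
  map_add' x y := by ext α; simp [mul_add]
  map_smul' a x := by ext α; simp [mul_left_comm]

lemma torusLinearMap_injective (t : Fin n → ℂˣ) :
    Function.Injective (torusLinearMap (Δ := Δ) t) := fun _ _ h => funext fun α =>
  mul_left_cancel₀ (Units.ne_zero (∏ i, t i ^ α.1 i)) (congrFun h α)

/-- The action of `t ∈ (ℂ^*)ⁿ` on the ambient projective space. -/
def projectiveTorusAction (t : Fin n → ℂˣ) :
    ℙ ℂ (Δ.LatticePoint → ℂ) → ℙ ℂ (Δ.LatticePoint → ℂ) :=
  Projectivization.map (torusLinearMap t) (torusLinearMap_injective t)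

lemma mapsTo_projectiveTorusAction (t : Fin n → ℂˣ) :
    Set.MapsTo (projectiveTorusAction (Δ := Δ) t) (closure (Set.range Δ.torusPoint))
      (closure (Set.range Δ.torusPoint)) := by
  refine Set.MapsTo.closure ?_ ?_
  · rintro _ ⟨s, rfl⟩
    refine ⟨t * s, ?_⟩
    refine (Projectivization.mk_eq_mk_iff' ℂ _ _ _ _).2 ⟨1, funext fun α => ?_⟩
    simp [torusLinearMap, torusMonomials, mul_zpow, Finset.prod_mul_distrib]
  · refine isQuotientMap_mk'.continuous_iff.2 ?_
    have : Continuous fun x : {x : Δ.LatticePoint → ℂ // x ≠ 0} =>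
        (⟨torusLinearMap t x.1, fun h => x.2 (torusLinearMap_injective t (h.trans (by simp)))⟩ :
          {x : Δ.LatticePoint → ℂ // x ≠ 0}) := by
      refine Continuous.subtype_mk (continuous_pi fun α => ?_) _
      change Continuous fun x : {x : Δ.LatticePoint → ℂ // x ≠ 0} => Δ.torusMonomials t α * x.1 α
      exact continuous_const.mul (continuous_coord α)
    exact isQuotientMap_mk'.continuous.comp this

/-- The action of `t ∈ (ℂ^*)ⁿ` on `X_Δ`, `[x_α] ↦ [t^α x_α]`. -/
def torusAction (t : Fin n → ℂˣ) (p : Δ.ToricManifold) : Δ.ToricManifold :=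
  ⟨projectiveTorusAction t p.1, mapsTo_projectiveTorusAction t p.2⟩

namespace Vertex

variable (v : Δ.Vertex)

/-- The polytope `Δ` moved by an integral affine transformation of `ℝⁿ` so that it lies in the
positive orthant with the vertex `v` at the origin and the edges at `v` along the axes. -/
def normalForm : Set (Fin n → ℝ) :=
  {x | latticeToReal v.1 + ∑ i, x i • latticeToReal (v.edgeBasis i) ∈ Δ.carrier}

lemma isBounded_normalForm : Bornology.IsBounded v.normalForm := by
  obtain ⟨ρ, hρ⟩ := exists_realCoord v.edgeBasis
  let f : (Fin n → ℝ) → (Fin n → ℝ) := fun y i => ρ i (y - latticeToReal v.1)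
  have hf : Continuous f := continuous_pi fun i =>
    (ρ i).continuous_of_finiteDimensional.comp (continuous_id.sub continuous_const)
  refine (Δ.isCompact.image hf).isBounded.subset fun x hx => ⟨_, hx, funext fun i => ?_⟩
  simp only [f, add_sub_cancel_left]
  exact realCoord_eq hρ x i

lemma finite_lattice_smul_normalForm (k : ℕ) :
    {α : Fin n → ℤ | latticeToReal α ∈ (k : ℝ) • v.normalForm}.Finite :=
  finite_lattice_of_isBounded (v.isBounded_normalForm.smul₀ _)

/-- The function `φ_{Δ,p}(z) = k⁻¹ log ∑_{α ∈ kΔ ∩ ℤⁿ} |z^α|²` on `ℂⁿ`, where `Δ` is in normal form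
with respect to the vertex `v` corresponding to `p`. -/
def toricGrowthFunction (k : ℕ) (z : Fin n → ℂ) : ℝ :=
  (k : ℝ)⁻¹ * Real.log (∑ α ∈ (v.finite_lattice_smul_normalForm k).toFinset,
    ‖∏ i, z i ^ α i‖ ^ 2)

/-- The function `φ_{Δ,p}` on the tangent space `T_p X_Δ` at the fixed point `p` corresponding to the
vertex `v`.  Here `T_p X_Δ` is identified with `ℂⁿ ⊆ X_Δ` through the differential at `p` of the
coordinates `z` of the affine chart at `v`. -/
def tangentToricGrowthFunction (k : ℕ) (p : Δ.ToricManifold)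
    (ξ : TangentSpace 𝓘(ℂ, Fin n → ℂ) p) : EReal :=
  (v.toricGrowthFunction k
    (mfderiv 𝓘(ℂ, Fin n → ℂ) 𝓘(ℂ, Fin n → ℂ) v.chart p ξ) : EReal)

end Vertex

end DelzantPolytope

end

/-!
Fix the vertex `v` with `p = v.point` and use the affine chart `ℂⁿ ⊆ X_Δ` centred at `p`. Both growth
functions are compared with `log M²`, where `M(z) = max_w |z^(w - v)|` is the largest of the monomials
attached to the vertices `w` of `Δ`. A linear functional on `Δ` attains its maximum at a vertex, so
`|z^α| ≤ M(z)^k` for all lattice points `α` of `kΔ` in normal form (`Vertex.exists_dominant`). Hence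
the toric growth function is `log M² + O(1)`, the error being governed by the number of lattice points
of `kΔ` (`Vertex.exists_abs_toricGrowthFunction_sub_le`).

For the same reason `X_Δ` is covered by the closed unit polydiscs of the affine charts, so a smooth
metric `φ` of `L_Δ` differs from `log M²` by a bounded amount (`Vertex.abs_metric_sub_le`). Let `s` be
a section of `kL_Δ` in the unit ball and `F` the entire function that represents it on `ℂⁿ`; then
`|F|² ≤ e^{kC} M^{2k}`. A homogeneous part of `F` at `ξ` is a Fourier coefficient of `F` on the circle
`{ζξ : |ζ| = 1}`, where `M` is constant, so it satisfies the same bound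
(`Vertex.inv_mul_log_hom_le`). It is not necessary to know that `F` is a polynomial. Conversely, a
fixed multiple of each coordinate `x_w` lies in the unit ball of sections of `L_Δ`, and its leading
part is a multiple of `z^(w - v)` (`Vertex.hom_vertexSection`). So the supremum that defines the
canonical growth function lies within a bounded distance of `log M²`, hence of the toric growth
function; since the latter is continuous, this persists after upper semicontinuous regularization.

Plurisubharmonicity of the regularized supremum follows from Jensen's inequality for `log |s_hom|²`
and a compactness argument on circles (`SubMeanValue.isPlurisubharmonic_limsup`); for the toric growth
function, `log ∑ |fⱼ|²` is a supremum of functions `log |∑ aⱼ fⱼ|²`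
(`subMeanValue_mul_log_sum_norm_sq`). As the order of vanishing is defined by iterated Fréchet
derivatives, Cauchy's estimate for them requires that complex differentiable functions on `ℂⁿ` are
smooth, which is Osgood's lemma (`Differentiable.contDiff_complex`).
-/

noncomputable section

/-! ### The sub-mean value property -/

/-- The sub-mean value inequality on complex circles, without any semicontinuity requirement: the
third clause in the definition of plurisubharmonic functions. -/
def SubMeanValue {V : Type*} [AddCommGroup V] [Module ℂ V] (u : V → EReal) : Prop :=
  ∀ (z w : V) (h : ℂ → ℝ), ContinuousOn h (Metric.sphere 0 1) →
    (∀ ζ ∈ Metric.sphere (0 : ℂ) 1, u (z + ζ • w) ≤ (h ζ : EReal)) →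
    u z ≤ ((Real.circleAverage h 0 1 : ℝ) : EReal)

section SubMeanValue

variable {V : Type*} [AddCommGroup V] [Module ℂ V]

lemma SubMeanValue.iSup {ι : Sort*} {u : ι → V → EReal} (hu : ∀ i, SubMeanValue (u i)) :
    SubMeanValue fun z => ⨆ i, u i z := fun z w h hh hle =>
  iSup_le fun i => hu i z w h hh fun ζ hζ => (le_iSup (fun i => u i (z + ζ • w)) i).trans (hle ζ hζ)

/-- **Jensen's inequality** for the logarithm of the modulus of an entire function. The upper bound
`h` is only needed away from the zeros of `G`, where `Real.log 0 = 0` is not meaningful. -/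
lemma mul_log_norm_le_circleAverage {G : ℂ → ℂ} (hG : Differentiable ℂ G) (hG0 : G 0 ≠ 0) {c : ℝ}
    (hc : 0 ≤ c) {h : ℂ → ℝ} (hh : ContinuousOn h (Metric.sphere 0 1))
    (hle : ∀ ζ ∈ Metric.sphere (0 : ℂ) 1, G ζ ≠ 0 → c * Real.log ‖G ζ‖ ≤ h ζ) :
    c * Real.log ‖G 0‖ ≤ Real.circleAverage h 0 1 := by
  have hA : ∀ U : Set ℂ, AnalyticOnNhd ℂ G U := fun U z _ => hG.analyticAt z
  have hint : CircleIntegrable (fun ζ => Real.log ‖G ζ‖) 0 1 :=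
    (hA _).meromorphicOn.circleIntegrable_log_norm
  have hJ := (hA (Metric.closedBall 0 |1|)).circleAverage_log_norm one_ne_zero hG0
  have h1 : Real.log ‖G 0‖ ≤ Real.circleAverage (fun ζ => Real.log ‖G ζ‖) 0 1 := by
    rw [hJ]
    refine le_add_of_nonneg_left (finsum_nonneg fun u => ?_)
    by_cases hu : u ∈ Metric.closedBall (0 : ℂ) |1|
    · refine mul_nonneg (mod_cast MeromorphicOn.AnalyticOnNhd.divisor_nonneg (hA _) u) ?_
      have hu' : ‖u‖ ≤ 1 := by simpa using hu
      rcases eq_or_ne u 0 with rfl | h0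
      · simp
      · refine Real.log_nonneg ?_
        simpa using (one_le_inv₀ (norm_pos_iff.2 h0)).2 hu'
    · simp [Function.locallyFinsuppWithin.apply_eq_zero_of_notMem _ hu]
  -- `h` is replaced by `0` at the zeros of `G`, which are discrete and do not affect the average.
  set h' : ℂ → ℝ := fun ζ => if G ζ = 0 then 0 else h ζ with hh'
  have hcod : h =ᶠ[codiscreteWithin (Metric.sphere (0 : ℂ) |1|)] h' := by
    have hne : ∀ᶠ x in codiscreteWithin (univ : Set ℂ), G x ≠ 0 :=
      ((hA univ).eqOn_zero_or_eventually_ne_zero_of_preconnected isPreconnected_univ).resolve_left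
        fun h0 => hG0 (h0 (mem_univ 0))
    have := codiscreteWithin_mono (subset_univ (Metric.sphere (0 : ℂ) |1|)) hne
    filter_upwards [this] with ζ hζ
    simp only [hh']
    rw [if_neg hζ]
  have hhint : CircleIntegrable h 0 1 := hh.circleIntegrable zero_le_one
  rw [Real.circleAverage_congr_codiscreteWithin hcod one_ne_zero]
  calc c * Real.log ‖G 0‖ ≤ c * Real.circleAverage (fun ζ => Real.log ‖G ζ‖) 0 1 := by gcongr
    _ = Real.circleAverage (fun ζ => c * Real.log ‖G ζ‖) 0 1 := by
        simpa using (Real.circleAverage_fun_smul (a := c) (f := fun ζ => Real.log ‖G ζ‖)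
          (c := 0) (R := 1)).symm
    _ ≤ _ := by
        refine Real.circleAverage_mono (hint.const_smul (a := c))
          (hhint.congr_codiscreteWithin hcod) fun ζ hζ => ?_
        simp only [hh']
        split_ifs with h0
        · simp [h0]
        · exact hle ζ (by simpa using hζ) h0

lemma log_enorm_sq {x : ℂ} (hx : x ≠ 0) :
    ENNReal.log (‖x‖ₑ ^ 2) = ((2 * Real.log ‖x‖ : ℝ) : EReal) := by
  have h1 : ‖x‖ₑ ^ 2 = ENNReal.ofReal (‖x‖ ^ 2) := by
    rw [← ofReal_norm, ENNReal.ofReal_pow (norm_nonneg _)]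
  have h2 : 0 < ‖x‖ ^ 2 := by positivity
  rw [h1, ENNReal.log_ofReal_of_pos h2, Real.log_pow]
  norm_num

lemma subMeanValue_mul_log_enorm_sq {P : V → ℂ}
    (hP : ∀ z w : V, Differentiable ℂ fun ζ : ℂ => P (z + ζ • w)) {c : ℝ} (hc : 0 < c) :
    SubMeanValue fun z => (c : EReal) * ENNReal.log (‖P z‖ₑ ^ 2) := by
  intro z w h hh hle
  by_cases h0 : P z = 0
  · simp [h0, EReal.coe_mul_bot_of_pos hc]
  · have := mul_log_norm_le_circleAverage (hP z w) (by simpa using h0) (c := c * 2) (by positivity)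
      hh fun ζ hζ hne => ?_
    · simp only [zero_smul, add_zero] at this
      dsimp only
      rw [log_enorm_sq h0, ← EReal.coe_mul, EReal.coe_le_coe_iff, ← mul_assoc]
      exact this
    · have := hle ζ hζ
      dsimp only at this
      rw [log_enorm_sq hne, ← EReal.coe_mul, EReal.coe_le_coe_iff, ← mul_assoc] at this
      exact this

/-- The function `log ∑ |fⱼ|²` is, at each point `z`, the maximum of the functions
`log |∑ aⱼ fⱼ|²` over the unit vectors `a`; the maximum is attained when `a` is proportional to the
conjugate of `f z`. -/
lemma subMeanValue_mul_log_sum_norm_sq {J : Type*} (s : Finset J) {f : J → V → ℂ}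
    (hf : ∀ j ∈ s, ∀ z w : V, Differentiable ℂ fun ζ : ℂ => f j (z + ζ • w))
    (hpos : ∀ z, 0 < ∑ j ∈ s, ‖f j z‖ ^ 2) {c : ℝ} (hc : 0 ≤ c) :
    SubMeanValue fun z => ((c * Real.log (∑ j ∈ s, ‖f j z‖ ^ 2) : ℝ) : EReal) := by
  intro z w h hh hle
  set S : V → ℝ := fun z => ∑ j ∈ s, ‖f j z‖ ^ 2 with hS
  set G : ℂ → ℂ := fun ζ => ∑ j ∈ s, starRingEnd ℂ (f j z) * f j (z + ζ • w) with hGdef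
  have hGd : Differentiable ℂ G := by
    simp only [hGdef]
    exact Differentiable.fun_sum fun j hj => (hf j hj z w).const_mul _
  have hG0 : G 0 = ((S z : ℝ) : ℂ) := by
    simp only [hGdef, hS, zero_smul, add_zero, Complex.ofReal_sum]
    refine Finset.sum_congr rfl fun j _ => ?_
    rw [← Complex.normSq_eq_conj_mul_self, Complex.normSq_eq_norm_sq]
  have hCS : ∀ ζ, ‖G ζ‖ ^ 2 ≤ S z * S (z + ζ • w) := by
    intro ζ
    have h1 : ‖G ζ‖ ≤ ∑ j ∈ s, ‖f j z‖ * ‖f j (z + ζ • w)‖ :=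
      (norm_sum_le _ _).trans_eq (Finset.sum_congr rfl fun j _ => by simp)
    calc ‖G ζ‖ ^ 2 ≤ (∑ j ∈ s, ‖f j z‖ * ‖f j (z + ζ • w)‖) ^ 2 := by gcongr
      _ ≤ _ := Finset.sum_mul_sq_le_sq_mul_sq _ _ _
  have hn0 : ‖G 0‖ = S z := by rw [hG0, Complex.norm_real, Real.norm_of_nonneg (hpos z).le]
  have key := mul_log_norm_le_circleAverage hGd
    (by rw [← norm_ne_zero_iff, hn0]; exact (hpos z).ne') (c := 2 * c) (by positivity)
    (h := fun ζ => c * Real.log (S z) + h ζ) (by fun_prop) fun ζ hζ hne => by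
      have h1 := hle ζ hζ
      rw [EReal.coe_le_coe_iff] at h1
      have h2 : Real.log (‖G ζ‖ ^ 2) ≤ Real.log (S z * S (z + ζ • w)) :=
        Real.log_le_log (by positivity) (hCS ζ)
      rw [Real.log_pow, Real.log_mul (hpos _).ne' (hpos _).ne'] at h2
      push_cast at h2
      calc 2 * c * Real.log ‖G ζ‖ = c * (2 * Real.log ‖G ζ‖) := by ring
        _ ≤ c * (Real.log (S z) + Real.log (S (z + ζ • w))) := by gcongr
        _ ≤ _ := by rw [mul_add]; gcongr
  rw [hn0, Real.circleAverage_fun_add (circleIntegrable_const _ _ _)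
    (hh.circleIntegrable zero_le_one), Real.circleAverage_const] at key
  rw [EReal.coe_le_coe_iff]
  change c * Real.log (S z) ≤ _
  linarith

variable [TopologicalSpace V] [ContinuousAdd V] [ContinuousSMul ℂ V]

/-- The upper semicontinuous regularization of a function that is locally bounded above and has the
sub-mean value property is plurisubharmonic. If the regularization is at most `h` on a circle, then by compactness
of the circle the function itself is less than `h + ε` on all slightly translated circles. -/
lemma SubMeanValue.isPlurisubharmonic_limsup {f : V → EReal} (hf : SubMeanValue f)
    (htop : ∀ z, limsup f (𝓝 z) ≠ ⊤) : IsPlurisubharmonic fun z => limsup f (𝓝 z) := by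
  refine ⟨htop, fun z y hy => ?_, fun z w h hh hle => ?_⟩
  · obtain ⟨c, hc, hcy⟩ := exists_between hy
    have h1 : ∀ᶠ x in 𝓝 z, f x < c := eventually_lt_of_limsup_lt hc
    filter_upwards [eventually_eventually_nhds.2 h1] with x hx
    exact (limsup_le_of_le (by isBoundedDefault) (hx.mono fun _ h => h.le)).trans_lt hcy
  · refine EReal.le_of_forall_lt_iff_le.1 fun r hr => ?_
    rw [EReal.coe_lt_coe_iff] at hr
    set ε := r - Real.circleAverage h 0 1 with hε
    have hε0 : 0 < ε := by linarith
    have hnear : ∀ᶠ η in 𝓝 z, ∀ ζ ∈ Metric.sphere (0 : ℂ) 1,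
        ζ ∈ Metric.sphere (0 : ℂ) 1 → f (η + ζ • w) ≤ ((h ζ + ε : ℝ) : EReal) := by
      refine (isCompact_sphere (0 : ℂ) 1).eventually_forall_of_forall_eventually fun ζ hζ => ?_
      have h1 : limsup f (𝓝 (z + ζ • w)) < ((h ζ + ε / 2 : ℝ) : EReal) :=
        (hle ζ hζ).trans_lt (EReal.coe_lt_coe_iff.2 (by linarith))
      have h2 : ∀ᶠ q : V × ℂ in 𝓝 (z, ζ), f (q.1 + q.2 • w) < ((h ζ + ε / 2 : ℝ) : EReal) := by
        have hcont : Continuous fun q : V × ℂ => q.1 + q.2 • w := by fun_prop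
        exact (hcont.tendsto (z, ζ)).eventually (eventually_lt_of_limsup_lt h1)
      have h3 : ∀ᶠ ζ' in 𝓝 ζ, ζ' ∈ Metric.sphere (0 : ℂ) 1 → h ζ - ε / 2 < h ζ' :=
        eventually_nhdsWithin_iff.1
          ((hh ζ hζ).eventually (lt_mem_nhds (a := h ζ - ε / 2) (by linarith)))
      filter_upwards [h2, (continuous_snd.tendsto (z, ζ)).eventually h3] with q hq1 hq2 hq3
      refine hq1.le.trans (EReal.coe_le_coe_iff.2 ?_)
      have := hq2 hq3
      linarith
    refine limsup_le_of_le (by isBoundedDefault) (hnear.mono fun η hη => ?_)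
    have := hf η w (fun ζ => h ζ + ε) (by fun_prop) fun ζ hζ => hη ζ hζ hζ
    rw [Real.circleAverage_fun_add (hh.circleIntegrable zero_le_one)
      (circleIntegrable_const _ _ _), Real.circleAverage_const] at this
    convert this using 2
    rw [hε]; ring

end SubMeanValue

/-! ### Entire functions of several variables -/

section Entire

variable {E : Type*} [NormedAddCommGroup E] [NormedSpace ℂ E]

lemma Differentiable.fderiv_apply_eq_circleIntegral {F : E → ℂ} (hF : Differentiable ℂ F)
    (z v : E) : fderiv ℂ F z v =
      (2 * Real.pi * Complex.I)⁻¹ * ∮ ζ in C(0, 1), (1 / ζ ^ 2) * F (z + ζ • v) := by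
  have hd : Differentiable ℂ fun ζ : ℂ => F (z + ζ • v) := by fun_prop
  have h1 : HasDerivAt (fun ζ : ℂ => F (z + ζ • v)) (fderiv ℂ F z v) 0 := by
    have h2 : HasDerivAt (fun ζ : ℂ => z + ζ • v) v 0 := by
      simpa using ((hasDerivAt_id (0 : ℂ)).smul_const v).const_add z
    have h3 : HasFDerivAt F (fderiv ℂ F z) (z + (0 : ℂ) • v) := by
      simpa using (hF z).hasFDerivAt
    exact h3.comp_hasDerivAt 0 h2
  have h4 := hd.differentiableOn.deriv_eq_smul_circleIntegral (c := 0) one_pos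
  rw [h1.deriv] at h4
  simp only [sub_zero, smul_eq_mul] at h4
  rw [h4, inv_mul_cancel_left₀ (by simp [Real.pi_ne_zero])]

lemma HolomorphicLineBundle.differentiable_leadingPart_line (F : E → ℂ) (q z w : E) :
    Differentiable ℂ fun ζ : ℂ => leadingPart F q (z + ζ • w) := by
  have h := (iteratedFDeriv ℂ (vanishingOrder F q) F q).contDiff (n := 1)
  exact ((h.differentiable one_ne_zero).comp
    (differentiable_pi.2 fun _ => by fun_prop)).const_mul _

variable [FiniteDimensional ℂ E]

/-- The directional derivatives of an entire function are entire: they are given by Cauchy's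
integral formula along complex lines, which is differentiated under the integral sign. The
derivative of the integrand is bounded by Cauchy's estimate. -/
lemma Differentiable.fderiv_apply_complex {F : E → ℂ} (hF : Differentiable ℂ F) (v : E) :
    Differentiable ℂ fun z => fderiv ℂ F z v := by
  have := FiniteDimensional.proper ℂ E
  borelize E
  intro z₀
  set g : ℝ → ℂ := fun θ => _root_.deriv (circleMap 0 1) θ * (1 / circleMap 0 1 θ ^ 2) with hg
  have hgc : Continuous g := by
    have h0 : ∀ θ, circleMap 0 1 θ ^ 2 ≠ 0 := fun θ => pow_ne_zero _ (by simp)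
    simp only [hg, deriv_circleMap]
    fun_prop (disch := assumption)
  have hgn : ∀ θ, ‖g θ‖ = 1 := fun θ => by simp [hg, deriv_circleMap]
  -- The radius covers a unit ball of base points, the displacement by `ζ • v`, and a unit ball for
  -- Cauchy's estimate.
  obtain ⟨C, hC⟩ := (isCompact_closedBall z₀ (2 + ‖v‖)).exists_bound_of_continuousOn
    hF.continuous.continuousOn
  have hbound : ∀ y ∈ Metric.closedBall z₀ (1 + ‖v‖), ‖fderiv ℂ F y‖ ≤ 2 * C := by
    intro y hy
    have hsub : ∀ x ∈ Metric.closedBall y 1, ‖F x‖ ≤ C := fun x hx => by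
      refine hC x ?_
      have := dist_triangle x y z₀
      rw [Metric.mem_closedBall] at hx hy ⊢
      linarith
    have := Complex.norm_fderiv_le_div_of_mapsTo_ball (R₁ := 1) (R₂ := 2 * C) (c := y)
      hF.differentiableOn (fun x hx => ?_) one_pos
    · simpa using this
    · rw [Metric.mem_closedBall, dist_eq_norm_sub]
      have h1 := hsub x (Metric.ball_subset_closedBall hx)
      have h2 := hsub y (by simp)
      have := norm_sub_le (F x) (F y)
      linarith
  have hcirc : ∀ θ : ℝ, ‖circleMap 0 1 θ • v‖ = ‖v‖ := fun θ => by simp [norm_smul]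
  have key := (intervalIntegral.hasFDerivAt_integral_of_dominated_of_fderiv_le (𝕜 := ℂ)
    (μ := MeasureTheory.volume) (a := 0) (b := 2 * Real.pi) (x₀ := z₀)
    (s := Metric.ball z₀ 1) (F := fun z θ => g θ * F (z + circleMap 0 1 θ • v))
    (F' := fun z θ => g θ • fderiv ℂ F (z + circleMap 0 1 θ • v)) (bound := fun _ => 2 * C)
    (Metric.ball_mem_nhds z₀ one_pos) ?_ ?_ ?_ ?_ ?_ ?_).differentiableAt
  · refine DifferentiableAt.congr_of_eventuallyEq
      (key.const_mul (2 * Real.pi * Complex.I : ℂ)⁻¹) (Eventually.of_forall fun z => ?_)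
    dsimp only
    rw [hF.fderiv_apply_eq_circleIntegral, circleIntegral]
    simp only [hg, smul_eq_mul, mul_assoc]
  · have := hF.continuous
    exact Eventually.of_forall fun z =>
      Continuous.aestronglyMeasurable (by fun_prop)
  · have := hF.continuous
    exact Continuous.intervalIntegrable (by fun_prop) _ _
  · refine (hgc.measurable.aestronglyMeasurable).smul ?_
    refine Measurable.aestronglyMeasurable ?_
    exact (measurable_fderiv ℂ F).comp (Continuous.measurable (by fun_prop))
  · refine Eventually.of_forall fun θ _ x hx => ?_
    rw [norm_smul, hgn, one_mul]
    refine hbound _ ?_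
    rw [Metric.mem_ball, dist_eq_norm_sub] at hx
    rw [Metric.mem_closedBall, dist_eq_norm_sub, add_sub_right_comm]
    refine (norm_add_le _ _).trans ?_
    rw [hcirc]
    linarith
  · exact intervalIntegrable_const
  · refine Eventually.of_forall fun θ _ x _ => ?_
    have h1 : HasFDerivAt (fun x => x + circleMap 0 1 θ • v) (ContinuousLinearMap.id ℂ E) x :=
      (hasFDerivAt_id x).add_const _
    exact ((hF _).hasFDerivAt.comp x h1).const_mul (g θ)

/-- **Osgood's lemma**: a complex differentiable function of finitely many variables has continuous
derivatives of all orders. -/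
lemma Differentiable.contDiff_complex {F : E → ℂ} (hF : Differentiable ℂ F) (d : ℕ) :
    ContDiff ℂ d F := by
  induction d generalizing F with
  | zero => exact contDiff_zero.2 hF.continuous
  | succ d ih =>
    push_cast
    exact contDiff_succ_iff_fderiv_apply.2
      ⟨hF, fun h => absurd h (by simp), fun y => ih (hF.fderiv_apply_complex y)⟩

/-! ### Leading homogeneous parts -/

namespace HolomorphicLineBundle

lemma homogeneousPart_zero_eq_iteratedDeriv {F : E → ℂ} (hF : Differentiable ℂ F) (d : ℕ) (ξ : E) :
    homogeneousPart F 0 d ξ =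
      (d.factorial : ℂ)⁻¹ * iteratedDeriv d (fun ζ : ℂ => F (ζ • ξ)) 0 := by
  have h := ((ContinuousLinearMap.id ℂ ℂ).smulRight ξ).iteratedFDeriv_comp_right
    (hF.contDiff_complex d) (0 : ℂ) le_rfl
  have h1 : F ∘ ((ContinuousLinearMap.id ℂ ℂ).smulRight ξ) = fun ζ : ℂ => F (ζ • ξ) := by
    ext ζ; simp
  rw [h1] at h
  rw [homogeneousPart, iteratedDeriv_eq_iteratedFDeriv, h]
  simp

/-- The homogeneous parts of an entire function are Fourier coefficients along circles, so they are
bounded by the maximum of the function on the circle through the point. -/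
lemma norm_homogeneousPart_le {F : E → ℂ} (hF : Differentiable ℂ F) (d : ℕ) (ξ : E) {C : ℝ}
    (hC : ∀ ζ ∈ Metric.sphere (0 : ℂ) 1, ‖F (ζ • ξ)‖ ≤ C) : ‖homogeneousPart F 0 d ξ‖ ≤ C := by
  rw [homogeneousPart_zero_eq_iteratedDeriv hF, norm_mul, norm_inv, Complex.norm_natCast]
  have hd : Differentiable ℂ fun ζ : ℂ => F (ζ • ξ) := by fun_prop
  have h := Complex.norm_iteratedDeriv_le_of_forall_mem_sphere_norm_le d one_pos hd.diffContOnCl hC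
  rw [one_pow, div_one] at h
  rwa [inv_mul_le_iff₀ (by positivity)]

lemma leadingPart_zero_eq_self {F : E → ℂ} (hF : Differentiable ℂ F) {d : ℕ}
    (hd : ∀ (ζ : ℂ) (ξ : E), F (ζ • ξ) = ζ ^ d * F ξ) (hne : ∃ ξ, F ξ ≠ 0) :
    leadingPart F 0 = F := by
  have h1 : ∀ e ξ, homogeneousPart F 0 e ξ = if e = d then F ξ else 0 := by
    intro e ξ
    rw [homogeneousPart_zero_eq_iteratedDeriv hF]
    simp only [hd]
    rw [iteratedDeriv_mul_const_field, iteratedDeriv_fun_pow_zero]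
    split_ifs with he
    · subst he
      have : (e.factorial : ℂ) ≠ 0 := by exact_mod_cast e.factorial_ne_zero
      field_simp
    · simp
  have h2 : {e | ∃ ξ, homogeneousPart F 0 e ξ ≠ 0} = {d} := by
    obtain ⟨ξ, hξ⟩ := hne
    ext e
    simp only [h1, mem_ofPred_eq, mem_singleton_iff]
    refine ⟨fun ⟨ξ, h⟩ => ?_, fun h => ⟨ξ, by simpa [h] using hξ⟩⟩
    by_contra hed
    simp [hed] at h
  funext ξ
  rw [leadingPart, vanishingOrder, h2, csInf_singleton, h1, if_pos rfl]

end HolomorphicLineBundle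

end Entire

/-! ### Monomials of a Delzant polytope and its vertices -/

namespace DelzantPolytope

variable {n : ℕ} {Δ : DelzantPolytope n}

instance : Nonempty Δ.Vertex := ⟨(exists_vertex_max (Δ := Δ) 0).choose⟩

namespace Vertex

variable (v : Δ.Vertex)

lemma latticeToReal_eq_add_sum_exponent (α : Δ.LatticePoint) :
    latticeToReal α.1 = latticeToReal v.1 +
      ∑ i, (v.exponent α i : ℝ) • latticeToReal (v.edgeBasis i) := by
  have h := v.edgeBasis.sum_repr (α.1 - v.1)
  ext j
  have hj := congrFun h j
  simp only [Finset.sum_apply, Pi.smul_apply, smul_eq_mul, Pi.sub_apply, ← exponent_cast] at hj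
  simp only [latticeToReal, Pi.add_apply, Finset.sum_apply, Pi.smul_apply, smul_eq_mul]
  have := congrArg (Int.cast (R := ℝ)) hj
  push_cast at this
  linarith

lemma exponent_mem_normalForm (α : Δ.LatticePoint) :
    (fun i => (v.exponent α i : ℝ)) ∈ v.normalForm := by
  change latticeToReal v.1 + ∑ i, (v.exponent α i : ℝ) • latticeToReal (v.edgeBasis i) ∈ Δ.carrier
  rw [← v.latticeToReal_eq_add_sum_exponent]
  exact α.2

lemma nonneg_of_mem_normalForm {x : Fin n → ℝ} (hx : x ∈ v.normalForm) (i : Fin n) : 0 ≤ x i := by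
  obtain ⟨ρ, hρ⟩ := exists_realCoord v.edgeBasis
  obtain ⟨c, hc, hcx⟩ := v.exists_cone_coord hx
  have := congrArg (ρ i) (add_left_cancel hcx)
  rw [realCoord_eq hρ, realCoord_eq hρ] at this
  exact this ▸ hc i

/-- A linear functional attains its maximum over `Δ`, in normal form at `v`, at a vertex. -/
lemma exists_vertex_max_normalForm (l : Fin n → ℝ) : ∃ w : Δ.Vertex, ∀ x ∈ v.normalForm,
    ∑ i, x i * l i ≤ ∑ i, (v.exponent w.toLatticePoint i : ℝ) * l i := by
  obtain ⟨ρ, hρ⟩ := exists_realCoord v.edgeBasis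
  set Λ : (Fin n → ℝ) →ₗ[ℝ] ℝ := ∑ i, l i • ρ i with hΛ
  obtain ⟨w, hw⟩ := exists_vertex_max (Δ := Δ) Λ.toContinuousLinearMap
  have hval : ∀ x : Fin n → ℝ, Λ (latticeToReal v.1 +
      ∑ i, x i • latticeToReal (v.edgeBasis i)) = Λ (latticeToReal v.1) + ∑ i, x i * l i := by
    intro x
    rw [map_add]
    congr 1
    simp only [hΛ, LinearMap.sum_apply, LinearMap.smul_apply, smul_eq_mul]
    exact Finset.sum_congr rfl fun i _ => by rw [realCoord_eq hρ, mul_comm]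
  refine ⟨w, fun x hx => ?_⟩
  have h1 := hw _ hx
  have h2 := v.latticeToReal_eq_add_sum_exponent w.toLatticePoint
  simp only [LinearMap.coe_toContinuousLinearMap'] at h1
  change latticeToReal w.1 = _ at h2
  rw [h2, hval, hval] at h1
  linarith

/-- If all coordinates of `z` are nonzero, `w` maximizes the linear functional with coefficients
`log |zᵢ|`; as there are finitely many vertices, the statement passes to the closure. -/
lemma exists_vertex_norm_prod_pow_le (z : Fin n → ℂ) {k : ℕ} {e : Fin n → ℕ}
    (he : (fun i => (e i : ℝ)) ∈ (k : ℝ) • v.normalForm) :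
    ∃ w : Δ.Vertex, ‖∏ i, z i ^ e i‖ ≤ ‖v.monomials z w.toLatticePoint‖ ^ k := by
  set K : Δ.Vertex → Set (Fin n → ℂ) := fun w =>
    {z | ‖∏ i, z i ^ e i‖ ≤ ‖v.monomials z w.toLatticePoint‖ ^ k} with hK
  have hclosed : IsClosed (⋃ w, K w) := isClosed_iUnion_of_finite fun w =>
    isClosed_le (by fun_prop) ((v.contDiff_monomials w.toLatticePoint).continuous.norm.pow k)
  have hdense : Dense {z : Fin n → ℂ | ∀ i, z i ≠ 0} := by
    have := dense_pi (Set.univ : Set (Fin n)) (s := fun _ => ({0}ᶜ : Set ℂ))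
      (fun i _ => dense_compl_singleton 0)
    convert this using 1
    ext z; simp
  have hsub : {z : Fin n → ℂ | ∀ i, z i ≠ 0} ⊆ ⋃ w, K w := by
    intro z hz
    have hnorm : ∀ f : Fin n → ℕ, ‖∏ i, z i ^ f i‖ = Real.exp (∑ i, f i * Real.log ‖z i‖) := by
      intro f
      rw [Real.exp_sum, norm_prod]
      refine Finset.prod_congr rfl fun i _ => ?_
      rw [norm_pow, Real.exp_nat_mul, Real.exp_log (norm_pos_iff.2 (hz i))]
    obtain ⟨w, hw⟩ := v.exists_vertex_max_normalForm fun i => Real.log ‖z i‖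
    refine mem_iUnion.2 ⟨w, ?_⟩
    obtain ⟨x, hx, hxe⟩ := he
    have hxe' : ∀ i, (e i : ℝ) = k * x i := fun i => (congrFun hxe i).symm
    change ‖∏ i, z i ^ e i‖ ≤ ‖∏ i, z i ^ v.exponent w.toLatticePoint i‖ ^ k
    rw [hnorm, hnorm, ← Real.exp_nat_mul]
    refine Real.exp_le_exp.2 ?_
    simp only [hxe', mul_assoc, ← Finset.mul_sum]
    exact mul_le_mul_of_nonneg_left (hw x hx) k.cast_nonneg
  exact mem_iUnion.1 (hclosed.closure_subset_iff.2 hsub (hdense z))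

/-- The vertex `w` is dominant at `z`, in the affine chart at `v`: for every `k`, the `k`-th power of
its monomial is at least as large as all monomials of `kΔ`, where `Δ` is in normal form at `v`. -/
def IsDominant (z : Fin n → ℂ) (w : Δ.Vertex) : Prop :=
  ∀ (k : ℕ) (e : Fin n → ℕ), (fun i => (e i : ℝ)) ∈ (k : ℝ) • v.normalForm →
    ‖∏ i, z i ^ e i‖ ≤ ‖v.monomials z w.toLatticePoint‖ ^ k

/-- At every point, the largest of the monomials attached to the vertices of `Δ` dominates all
monomials of the dilated polytopes `kΔ`. -/
lemma exists_dominant (z : Fin n → ℂ) : ∃ w : Δ.Vertex, v.IsDominant z w := by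
  obtain ⟨w, hw⟩ := Finite.exists_max fun w : Δ.Vertex => ‖v.monomials z w.toLatticePoint‖
  refine ⟨w, fun k e he => ?_⟩
  obtain ⟨w', hw'⟩ := v.exists_vertex_norm_prod_pow_le z he
  exact hw'.trans (pow_le_pow_left₀ (norm_nonneg _) (hw w') k)

variable {v} in
lemma IsDominant.norm_monomials_le {z : Fin n → ℂ} {w : Δ.Vertex} (hw : v.IsDominant z w)
    (α : Δ.LatticePoint) :
    ‖v.monomials z α‖ ≤ ‖v.monomials z w.toLatticePoint‖ := by
  simpa [monomials] using hw 1 (v.exponent α) (by simpa using v.exponent_mem_normalForm α)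

variable {v} in
lemma IsDominant.one_le_norm {z : Fin n → ℂ} {w : Δ.Vertex} (hw : v.IsDominant z w) :
    1 ≤ ‖v.monomials z w.toLatticePoint‖ := by
  simpa [monomials_self] using hw.norm_monomials_le v.toLatticePoint

/-! ### The toric growth function -/

lemma prod_zpow_eq {k : ℕ} {α : Fin n → ℤ} (hα : latticeToReal α ∈ (k : ℝ) • v.normalForm) :
    (fun i => ((α i).toNat : ℝ)) ∈ (k : ℝ) • v.normalForm ∧
      ∀ z : Fin n → ℂ, ∏ i, z i ^ α i = ∏ i, z i ^ (α i).toNat := by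
  have h0 : ∀ i, 0 ≤ α i := by
    obtain ⟨x, hx, hxα⟩ := hα
    intro i
    have h1 : (α i : ℝ) = k * x i := (congrFun hxα i).symm
    have h2 := mul_nonneg (k.cast_nonneg (α := ℝ)) (v.nonneg_of_mem_normalForm hx i)
    rw [← h1] at h2
    exact_mod_cast h2
  have hcast : ∀ i, (((α i).toNat : ℕ) : ℤ) = α i := fun i => Int.toNat_of_nonneg (h0 i)
  constructor
  · convert hα using 1
    funext i
    change _ = ((α i : ℤ) : ℝ)
    rw [← Int.cast_natCast, hcast]
  · intro z
    refine Finset.prod_congr rfl fun i _ => ?_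
    rw [← zpow_natCast, hcast]

lemma norm_monomials_pow_le_sum (k : ℕ) (z : Fin n → ℂ) (α : Δ.LatticePoint) :
    (‖v.monomials z α‖ ^ k) ^ 2 ≤ ∑ α ∈ (v.finite_lattice_smul_normalForm k).toFinset,
      ‖∏ i, z i ^ α i‖ ^ 2 := by
  have hmem : (fun i => (k : ℤ) * v.exponent α i) ∈
      (v.finite_lattice_smul_normalForm k).toFinset := by
    rw [Set.Finite.mem_toFinset]
    refine ⟨_, v.exponent_mem_normalForm α, ?_⟩
    ext i
    simp [latticeToReal]
  refine le_trans (le_of_eq ?_) (Finset.single_le_sum (f := fun α : Fin n → ℤ =>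
    ‖∏ i, z i ^ α i‖ ^ 2) (fun _ _ => sq_nonneg _) hmem)
  congr 1
  rw [← norm_pow, monomials, ← Finset.prod_pow]
  congr 1
  refine Finset.prod_congr rfl fun i _ => ?_
  rw [mul_comm, zpow_mul, zpow_natCast, zpow_natCast]

lemma sum_norm_sq_pos (k : ℕ) (z : Fin n → ℂ) :
    0 < ∑ α ∈ (v.finite_lattice_smul_normalForm k).toFinset, ‖∏ i, z i ^ α i‖ ^ 2 := by
  refine lt_of_lt_of_le one_pos ?_
  simpa [monomials_self] using v.norm_monomials_pow_le_sum k z v.toLatticePoint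

lemma continuous_toricGrowthFunction (k : ℕ) : Continuous (v.toricGrowthFunction k) := by
  refine continuous_const.mul (Continuous.log ?_ fun z => (v.sum_norm_sq_pos k z).ne')
  refine continuous_finsetSum _ fun α hα => ?_
  rw [Set.Finite.mem_toFinset] at hα
  simp only [(v.prod_zpow_eq hα).2]
  fun_prop

lemma isPlurisubharmonic_toricGrowthFunction (k : ℕ) :
    IsPlurisubharmonic fun z => (v.toricGrowthFunction k z : EReal) := by
  refine ⟨fun z => EReal.coe_ne_top _, ?_, ?_⟩
  · exact (continuous_coe_real_ereal.comp (v.continuous_toricGrowthFunction k)).upperSemicontinuous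
  · have h := subMeanValue_mul_log_sum_norm_sq (v.finite_lattice_smul_normalForm k).toFinset
      (f := fun α (z : Fin n → ℂ) => ∏ i, z i ^ α i) (fun α hα z w => ?_)
      (v.sum_norm_sq_pos k) (c := (k : ℝ)⁻¹) (by positivity)
    · exact h
    · rw [Set.Finite.mem_toFinset] at hα
      simp only [(v.prod_zpow_eq hα).2, Pi.add_apply, Pi.smul_apply]
      fun_prop

/-- Up to a bounded term, the toric growth function is the logarithm of the square of the dominant
vertex monomial. The number of lattice points of `kΔ` bounds the error. -/
lemma exists_abs_toricGrowthFunction_sub_le {k : ℕ} (hk : 1 ≤ k) : ∃ C : ℝ,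
    ∀ (z : Fin n → ℂ) (w : Δ.Vertex), v.IsDominant z w →
      |v.toricGrowthFunction k z - 2 * Real.log ‖v.monomials z w.toLatticePoint‖| ≤ C := by
  set A := (v.finite_lattice_smul_normalForm k).toFinset with hA
  refine ⟨(k : ℝ)⁻¹ * Real.log A.card, fun z w hw => ?_⟩
  set M := ‖v.monomials z w.toLatticePoint‖ with hM
  have hM1 : 1 ≤ M := hw.one_le_norm
  have hM0 : 0 < (M ^ k) ^ 2 := by positivity
  have hk0 : (0 : ℝ) < k := by exact_mod_cast hk
  have hlow : (M ^ k) ^ 2 ≤ ∑ α ∈ A, ‖∏ i, z i ^ α i‖ ^ 2 :=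
    v.norm_monomials_pow_le_sum k z w.toLatticePoint
  have hupp : ∑ α ∈ A, ‖∏ i, z i ^ α i‖ ^ 2 ≤ A.card * (M ^ k) ^ 2 := by
    rw [← nsmul_eq_mul]
    refine Finset.sum_le_card_nsmul _ _ _ fun α hα => ?_
    rw [hA, Set.Finite.mem_toFinset] at hα
    rw [(v.prod_zpow_eq hα).2]
    exact pow_le_pow_left₀ (norm_nonneg _) (hw k _ (v.prod_zpow_eq hα).1) 2
  have hcard : (0 : ℝ) < A.card := by
    by_contra! h
    exact absurd (hlow.trans hupp) (not_le.2 ((mul_nonpos_of_nonpos_of_nonneg h hM0.le).trans_lt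
      hM0))
  have hcard1 : 0 ≤ Real.log A.card := Real.log_natCast_nonneg _
  have hlog : Real.log ((M ^ k) ^ 2) = k * (2 * Real.log M) := by
    rw [Real.log_pow, Real.log_pow]; push_cast; ring
  have h1 : k * (2 * Real.log M) ≤ Real.log (∑ α ∈ A, ‖∏ i, z i ^ α i‖ ^ 2) :=
    hlog ▸ Real.log_le_log hM0 hlow
  have h2 : Real.log (∑ α ∈ A, ‖∏ i, z i ^ α i‖ ^ 2) ≤
      Real.log A.card + k * (2 * Real.log M) := by
    rw [← hlog, ← Real.log_mul hcard.ne' hM0.ne']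
    exact Real.log_le_log (hM0.trans_le hlow) hupp
  have h3 : v.toricGrowthFunction k z - 2 * Real.log M =
      (k : ℝ)⁻¹ * (Real.log (∑ α ∈ A, ‖∏ i, z i ^ α i‖ ^ 2) - k * (2 * Real.log M)) := by
    rw [mul_sub, inv_mul_cancel_left₀ hk0.ne', toricGrowthFunction]
  rw [h3, abs_of_nonneg (mul_nonneg (by positivity) (by linarith))]
  gcongr
  linarith

end Vertex

end DelzantPolytope

/-! ### Fixed points of the torus action -/

namespace DelzantPolytope

variable {n : ℕ} {Δ : DelzantPolytope n}

lemma exists_coord_torusAction (t : Fin n → ℂˣ) (p : Δ.ToricManifold) : ∃ a : ℂ, a ≠ 0 ∧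
    ∀ α, (torusAction t p).coord α = a * (Δ.torusMonomials t α * p.coord α) := by
  have hne : torusLinearMap t p.1.rep ≠ 0 := fun h =>
    p.1.rep_nonzero (torusLinearMap_injective t (h.trans (map_zero _).symm))
  obtain ⟨a, ha, h⟩ := exists_rep_mk' ⟨torusLinearMap t p.1.rep, hne⟩
  refine ⟨a, ha, fun α => ?_⟩
  have hp : (torusAction t p).1 = Projectivization.mk' ℂ ⟨torusLinearMap t p.1.rep, hne⟩ := by
    change Projectivization.map (torusLinearMap t) (torusLinearMap_injective t) p.1 = _
    conv_lhs => rw [← p.1.mk_rep]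
    rfl
  rw [ToricManifold.coord, hp, h]
  rfl

namespace Vertex

variable (v : Δ.Vertex)

/-- There is a one-parameter subgroup of the torus that acts on all affine coordinates at `v` with
weight one; here only its value at `2` is recorded. -/
lemma exists_torusMonomials_neighbor : ∃ t : Fin n → ℂˣ, ∀ i,
    Δ.torusMonomials t (v.neighbor i) = 2 * Δ.torusMonomials t v.toLatticePoint := by
  let u : ℂˣ := Units.mk0 2 two_ne_zero
  let σ : (Fin n → ℤ) →ₗ[ℤ] ℤ := ∑ l, v.edgeBasis.coord l
  have hσ : ∀ β : Fin n → ℤ, σ β = ∑ j, σ (Pi.single j 1) * β j := by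
    intro β
    have hβ : β = ∑ j, β j • (Pi.single j 1 : Fin n → ℤ) := by
      ext k; simp [Finset.sum_apply, Pi.single_apply]
    conv_lhs => rw [hβ, map_sum]
    exact Finset.sum_congr rfl fun j _ => by rw [map_zsmul, smul_eq_mul, mul_comm]
  have hσb : ∀ i, σ (v.edgeBasis i) = 1 := fun i => by
    simp [σ, Finsupp.single_apply]
  let t : Fin n → ℂˣ := fun j => u ^ σ (Pi.single j 1)
  have ht : ∀ α : Δ.LatticePoint, Δ.torusMonomials t α = ((u ^ σ α.1 : ℂˣ) : ℂ) := by
    intro α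
    simp only [torusMonomials, t]
    congr 1
    rw [hσ α.1, zpow_finset_sum]
    exact Finset.prod_congr rfl fun j _ => (zpow_mul _ _ _).symm
  refine ⟨t, fun i => ?_⟩
  rw [ht, ht]
  change ((u ^ σ (v.1 + v.edgeBasis i) : ℂˣ) : ℂ) = 2 * ((u ^ σ v.1 : ℂˣ) : ℂ)
  rw [map_add, hσb, zpow_add, zpow_one, mul_comm]
  simp [u]

lemma point_eq_of_forall_torusAction_eq {p : Δ.ToricManifold} (hv : p.coord v.toLatticePoint ≠ 0)
    (hp : ∀ t : Fin n → ℂˣ, torusAction t p = p) : v.point = p := by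
  obtain ⟨t, ht⟩ := v.exists_torusMonomials_neighbor
  obtain ⟨a, -, ha⟩ := exists_coord_torusAction t p
  rw [hp t] at ha
  have h1 : a * Δ.torusMonomials t v.toLatticePoint = 1 := by
    have := ha v.toLatticePoint
    rw [← mul_assoc] at this
    exact (mul_eq_right₀ hv).1 this.symm
  have h2 : ∀ i, p.coord (v.neighbor i) = 0 := by
    intro i
    have := ha (v.neighbor i)
    rw [ht, show a * (2 * Δ.torusMonomials t v.toLatticePoint * p.coord (v.neighbor i)) =
      2 * (a * Δ.torusMonomials t v.toLatticePoint) * p.coord (v.neighbor i) by ring, h1] at this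
    linear_combination -this
  have h3 : v.chart p = 0 := by
    funext i
    change p.coord (v.neighbor i) / _ = 0
    rw [h2, zero_div]
  rw [point, ← h3]
  exact v.chart.left_inv hv

lemma eq_of_coord_point_ne_zero {w : Δ.Vertex} (h : v.point.coord w.toLatticePoint ≠ 0) :
    w = v := by
  obtain ⟨a, ha, hc⟩ := v.coord_chart_symm 0
  rw [point, hc] at h
  have h1 : ∀ i, v.exponent w.toLatticePoint i = 0 := by
    intro i
    by_contra hi
    refine right_ne_zero_of_mul h (Finset.prod_eq_zero (Finset.mem_univ i) ?_)
    simp [hi]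
  have h2 := v.latticeToReal_eq_add_sum_exponent w.toLatticePoint
  simp only [h1, Nat.cast_zero, zero_smul, Finset.sum_const_zero, add_zero] at h2
  exact Subtype.ext (latticeToReal_injective h2)

lemma chartAt_point : chartAt (Fin n → ℂ) v.point = v.chart := by
  change (exists_coord_ne_zero v.point).choose.chart = v.chart
  rw [v.eq_of_coord_point_ne_zero (exists_coord_ne_zero v.point).choose_spec]

lemma chart_point : v.chart v.point = 0 := v.chart.right_inv (mem_univ _)

lemma mfderiv_chart_point (ξ : TangentSpace 𝓘(ℂ, Fin n → ℂ) v.point) :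
    mfderiv 𝓘(ℂ, Fin n → ℂ) 𝓘(ℂ, Fin n → ℂ) v.chart v.point ξ = ξ := by
  have h1 : IsManifold 𝓘(ℂ, Fin n → ℂ) 1 Δ.ToricManifold := IsManifold.of_le (n := ω) le_top
  have hs : v.point ∈ (chartAt (Fin n → ℂ) v.point).source := mem_chart_source _ _
  have h2 := mfderiv_chartAt_eq_tangentCoordChange (I := 𝓘(ℂ, Fin n → ℂ)) hs
  rw [chartAt_point] at h2
  have h4 := tangentCoordChange_self (I := 𝓘(ℂ, Fin n → ℂ)) (x := v.point) (z := v.point)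
    (v := ξ) (mem_extChartAt_source _)
  rw [h2]
  exact h4

lemma tangentToricGrowthFunction_point (k : ℕ) :
    v.tangentToricGrowthFunction k v.point = fun ξ => (v.toricGrowthFunction k ξ : EReal) := by
  funext ξ
  rw [tangentToricGrowthFunction, mfderiv_chart_point]

/-! ### Dominant vertices and the polydisc cover of `X_Δ` -/

variable {v}

lemma IsDominant.smul {z : Fin n → ℂ} {w : Δ.Vertex} (hw : v.IsDominant z w) {ζ : ℂ}
    (hζ : ‖ζ‖ = 1) : v.IsDominant (ζ • z) w := by
  have hn : ∀ e : Fin n → ℕ, ‖∏ i, (ζ • z) i ^ e i‖ = ‖∏ i, z i ^ e i‖ := fun e => by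
    simp [norm_prod, hζ]
  intro k e he
  rw [monomials, hn, hn]
  exact hw k e he

variable (v)

lemma coord_div_coord_chart_symm (z : Fin n → ℂ) (α β : Δ.LatticePoint) :
    ToricManifold.coord (v.chart.symm z) α / ToricManifold.coord (v.chart.symm z) β =
      v.monomials z α / v.monomials z β := by
  obtain ⟨a, ha, h⟩ := v.coord_chart_symm z
  rw [h, h, mul_div_mul_left _ _ ha]

lemma coord_chart_symm_ne_zero_iff (z : Fin n → ℂ) (α : Δ.LatticePoint) :
    ToricManifold.coord (v.chart.symm z) α ≠ 0 ↔ v.monomials z α ≠ 0 := by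
  obtain ⟨a, ha, h⟩ := v.coord_chart_symm z
  simp [h, ha]

variable {v}

/-- In the affine chart at a dominant vertex, the point has coordinates of modulus at most one. -/
lemma IsDominant.norm_chart_le {z : Fin n → ℂ} {w : Δ.Vertex} (hw : v.IsDominant z w) :
    ‖w.chart (v.chart.symm z)‖ ≤ 1 := by
  refine (pi_norm_le_iff_of_nonneg zero_le_one).2 fun i => ?_
  change ‖ToricManifold.coord (v.chart.symm z) (w.neighbor i) /
    ToricManifold.coord (v.chart.symm z) w.toLatticePoint‖ ≤ 1
  rw [coord_div_coord_chart_symm, norm_div]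
  exact div_le_one_of_le₀ (hw.norm_monomials_le _) (norm_nonneg _)

end Vertex

/-- `X_Δ` is covered by the closed unit polydiscs in the affine charts. Bounds over
`X_Δ` thus reduce to bounds over a compact polydisc. -/
lemma exists_norm_chart_le_one (p : Δ.ToricManifold) : ∃ w : Δ.Vertex,
    p.coord w.toLatticePoint ≠ 0 ∧ ‖w.chart p‖ ≤ 1 ∧
      ∀ α, ‖p.coord α‖ ≤ ‖p.coord w.toLatticePoint‖ := by
  obtain ⟨v, hv⟩ := exists_coord_ne_zero p
  have hp : v.chart.symm (v.chart p) = p := v.chart.left_inv hv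
  obtain ⟨w, hw⟩ := v.exists_dominant (v.chart p)
  have h1 := hw.norm_chart_le
  obtain ⟨a, ha, hc⟩ := v.coord_chart_symm (v.chart p)
  rw [hp] at h1 hc
  refine ⟨w, ?_, h1, fun α => ?_⟩
  · rw [hc]
    exact mul_ne_zero ha (norm_pos_iff.1 (one_pos.trans_le hw.one_le_norm))
  · rw [hc, hc, norm_mul, norm_mul]
    exact mul_le_mul_of_nonneg_left (hw.norm_monomials_le α) (norm_nonneg a)

/-- The number `C` bounds the weights of the metric `φ` on the closed unit polydiscs of the affine
charts, each in the trivialization belonging to the chart. -/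
def IsPolydiscBound (φ : Δ.lineBundle.SmoothMetric) (C : ℝ) : Prop :=
  ∀ (w : Δ.Vertex) (p : Δ.ToricManifold), p.coord w.toLatticePoint ≠ 0 → ‖w.chart p‖ ≤ 1 →
    |φ.φ w p| ≤ C

lemma exists_isPolydiscBound (φ : Δ.lineBundle.SmoothMetric) : ∃ C : ℝ, IsPolydiscBound φ C := by
  have h : ∀ w : Δ.Vertex, ∃ C : ℝ, ∀ z ∈ Metric.closedBall (0 : Fin n → ℂ) 1,
      ‖φ.φ w (w.chart.symm z)‖ ≤ C := by
    intro w
    refine (isCompact_closedBall (0 : Fin n → ℂ) 1).exists_bound_of_continuousOn ?_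
    refine (φ.smooth w).continuousOn.comp (w.chart.continuousOn_symm.mono fun _ _ => mem_univ _)
      fun z _ => w.chart.map_target (mem_univ z)
  choose C hC using h
  obtain ⟨D, hD⟩ := (Set.finite_range C).bddAbove
  refine ⟨D, fun w p hp hp1 => ?_⟩
  have h1 := hC w (w.chart p) (by simpa using hp1)
  rw [w.chart.left_inv hp] at h1
  exact h1.trans (hD ⟨w, rfl⟩)

end DelzantPolytope

/-! ### Sections in the unit ball -/

namespace DelzantPolytope

variable {n : ℕ} {Δ : DelzantPolytope n}

open HolomorphicLineBundle

lemma norm_sq_le_exp_of_supNormSq_le_one {k : ℕ} {φ : Δ.lineBundle.SmoothMetric}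
    {s : (Δ.lineBundle.tensorPower k).HolomorphicSection}
    (hs : s.supNormSq (φ.tensorPower k) ≤ 1) {w : Δ.Vertex} {p : Δ.ToricManifold}
    (hp : p.coord w.toLatticePoint ≠ 0) : ‖s.f w p‖ ^ 2 ≤ Real.exp (k * φ.φ w p) := by
  have h1 : ENNReal.ofReal (‖s.f w p‖ ^ 2 * Real.exp (-(k * φ.φ w p))) ≤ 1 :=
    (le_iSup_of_le (f := fun i : Δ.lineBundle.ι => ⨆ (x : Δ.ToricManifold)
      (_ : x ∈ Δ.lineBundle.U i),
        ENNReal.ofReal (‖s.f i x‖ ^ 2 * Real.exp (-(φ.tensorPower k).φ i x))) w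
      (le_iSup₂_of_le p hp le_rfl)).trans hs
  rw [ENNReal.ofReal_le_one, Real.exp_neg, ← div_eq_mul_inv, div_le_one (Real.exp_pos _)] at h1
  exact h1

namespace Vertex

variable (v : Δ.Vertex)

lemma differentiable_section_comp_chart_symm {k : ℕ}
    (s : (Δ.lineBundle.tensorPower k).HolomorphicSection) :
    Differentiable ℂ (s.f v ∘ v.chart.symm) := by
  have h1 : MDifferentiableOn 𝓘(ℂ, Fin n → ℂ) 𝓘(ℂ, Fin n → ℂ) v.chart.symm v.chart.target :=
    mdifferentiableOn_atlas_symm (Set.mem_range_self v)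
  have h2 := (s.holomorphic v).comp h1 fun z hz => v.chart.map_target hz
  rw [show v.chart.target = univ from rfl, mdifferentiableOn_univ] at h2
  exact h2.differentiable

lemma hom_point {k : ℕ} (s : (Δ.lineBundle.tensorPower k).HolomorphicSection) (ξ : Fin n → ℂ) :
    s.hom v v.point ξ = leadingPart (s.f v ∘ v.chart.symm) 0 ξ := by
  have h1 : (extChartAt 𝓘(ℂ, Fin n → ℂ) v.point v.point : Fin n → ℂ) = 0 := by
    rw [extChartAt_coe, chartAt_point]
    exact v.chart_point
  have h2 : ((extChartAt 𝓘(ℂ, Fin n → ℂ) v.point).symm : (Fin n → ℂ) → Δ.ToricManifold) =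
      v.chart.symm := by
    rw [extChartAt_coe_symm, chartAt_point]
    rfl
  change leadingPart (s.f v ∘ (extChartAt 𝓘(ℂ, Fin n → ℂ) v.point).symm)
    (extChartAt 𝓘(ℂ, Fin n → ℂ) v.point v.point) ξ = _
  rw [h1, h2]

/-- A metric differs by a bounded amount from the singular metric whose weight in the affine chart
at `v` is `max_w log |z^(w - v)|²`. -/
lemma abs_metric_sub_le {φ : Δ.lineBundle.SmoothMetric} {C : ℝ}
    (hC : IsPolydiscBound φ C)
    {z : Fin n → ℂ} {w : Δ.Vertex} (hw : v.IsDominant z w) :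
    |φ.φ v (v.chart.symm z) - 2 * Real.log ‖v.monomials z w.toLatticePoint‖| ≤ C := by
  have hv0 : ToricManifold.coord (v.chart.symm z) v.toLatticePoint ≠ 0 :=
    v.chart.map_target (mem_univ z)
  have hw0 : ToricManifold.coord (v.chart.symm z) w.toLatticePoint ≠ 0 :=
    (v.coord_chart_symm_ne_zero_iff z _).2 (norm_pos_iff.1 (one_pos.trans_le hw.one_le_norm))
  have h1 : φ.φ v (v.chart.symm z) = φ.φ w (v.chart.symm z) +
      Real.log (‖ToricManifold.coord (v.chart.symm z) w.toLatticePoint /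
        ToricManifold.coord (v.chart.symm z) v.toLatticePoint‖ ^ 2) :=
    φ.compatible v w _ ⟨hv0, hw0⟩
  rw [coord_div_coord_chart_symm, monomials_self, div_one, Real.log_pow] at h1
  rw [h1]
  push_cast
  rw [add_sub_cancel_right]
  exact hC w _ hw0 hw.norm_chart_le

/-- Upper bound for the leading parts of sections in the unit ball: by Cauchy's estimate on the
circle through `ξ`, on which the dominant vertex monomial has constant modulus. -/
lemma inv_mul_log_hom_le {φ : Δ.lineBundle.SmoothMetric} {C : ℝ}
    (hC : IsPolydiscBound φ C)
    {k : ℕ} (hk : 1 ≤ k) {s : (Δ.lineBundle.tensorPower k).HolomorphicSection}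
    (hs : s.supNormSq (φ.tensorPower k) ≤ 1) {ξ : Fin n → ℂ} {w : Δ.Vertex}
    (hw : v.IsDominant ξ w) :
    (((k : ℝ)⁻¹ : ℝ) : EReal) * ENNReal.log (‖s.hom v v.point ξ‖ₑ ^ 2) ≤
      ((2 * Real.log ‖v.monomials ξ w.toLatticePoint‖ + C : ℝ) : EReal) := by
  have hk0 : (0 : ℝ) < k := by exact_mod_cast hk
  set M := ‖v.monomials ξ w.toLatticePoint‖ with hM
  set B := 2 * Real.log M + C with hB
  rw [hom_point]
  have hbound : ∀ ζ ∈ Metric.sphere (0 : ℂ) 1,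
      ‖(s.f v ∘ v.chart.symm) (ζ • ξ)‖ ≤ Real.exp (k * B / 2) := by
    intro ζ hζ
    have hζ1 : ‖ζ‖ = 1 := by simpa using hζ
    have h1 := norm_sq_le_exp_of_supNormSq_le_one hs (w := v) (p := v.chart.symm (ζ • ξ))
      (v.chart.map_target (mem_univ _))
    have h2 := (abs_le.1 (v.abs_metric_sub_le hC (hw.smul hζ1))).2
    have h3 : ‖v.monomials (ζ • ξ) w.toLatticePoint‖ = M := by
      simp [hM, monomials, norm_prod, hζ1]
    rw [h3] at h2
    refine le_of_sq_le_sq (h1.trans ?_) (Real.exp_pos _).le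
    rw [← Real.exp_nat_mul]
    refine Real.exp_le_exp.2 ?_
    calc (k : ℝ) * φ.φ v (v.chart.symm (ζ • ξ)) ≤ k * B := by gcongr; linarith
      _ = _ := by push_cast; ring
  have hlead : ‖leadingPart (s.f v ∘ v.chart.symm) 0 ξ‖ ≤ Real.exp (k * B / 2) :=
    norm_homogeneousPart_le (v.differentiable_section_comp_chart_symm s) _ ξ hbound
  rcases eq_or_ne (leadingPart (s.f v ∘ v.chart.symm) 0 ξ) 0 with h0 | h0
  · rw [h0]
    simp [EReal.coe_mul_bot_of_pos, hk0]
  · rw [log_enorm_sq h0, ← EReal.coe_mul, EReal.coe_le_coe_iff, inv_mul_le_iff₀ hk0]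
    have h1 := Real.log_le_log (norm_pos_iff.2 h0) hlead
    rw [Real.log_exp] at h1
    linarith

/-- The section `c x_w` of `L_Δ`, as a section of its first tensor power. -/
def vertexSection (w : Δ.Vertex) (c : ℂ) : (Δ.lineBundle.tensorPower 1).HolomorphicSection where
  f u p := c * (p.coord w.toLatticePoint / p.coord (Vertex.toLatticePoint u))
  holomorphic u := by
    have h : Differentiable ℂ fun z : ℂ => c * z := by fun_prop
    exact h.mdifferentiable.comp_mdifferentiableOn (mdifferentiableOn_coord_ratio u w)
  compatible u u' p hp := by
    have h1 : p.coord (Vertex.toLatticePoint u') ≠ 0 := hp.2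
    change _ = (p.coord (Vertex.toLatticePoint u') / p.coord (Vertex.toLatticePoint u)) ^ 1 * _
    rw [pow_one]
    field_simp

lemma hom_vertexSection (w : Δ.Vertex) {c : ℂ} (hc : c ≠ 0) (ξ : Fin n → ℂ) :
    (vertexSection w c).hom v v.point ξ = c * v.monomials ξ w.toLatticePoint := by
  have hF : (vertexSection w c).f v ∘ v.chart.symm =
      fun z => c * v.monomials z w.toLatticePoint := by
    funext z
    change c * (ToricManifold.coord (v.chart.symm z) w.toLatticePoint /
      ToricManifold.coord (v.chart.symm z) v.toLatticePoint) = _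
    rw [coord_div_coord_chart_symm, monomials_self, div_one]
  have hd := v.differentiable_section_comp_chart_symm (vertexSection w c)
  rw [hom_point, leadingPart_zero_eq_self hd (d := ∑ i, v.exponent w.toLatticePoint i), hF]
  · intro ζ z
    simp only [hF, monomials, Pi.smul_apply, smul_eq_mul, mul_pow, Finset.prod_mul_distrib,
      Finset.prod_pow_eq_pow_sum]
    ring
  · exact ⟨fun _ => 1, by rw [hF]; simp [monomials, hc]⟩

lemma isNonzero_vertexSection (w : Δ.Vertex) {c : ℂ} (hc : c ≠ 0) :
    (vertexSection w c).IsNonzero := by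
  have h : w.point.coord w.toLatticePoint ≠ 0 := w.chart.map_target (mem_univ 0)
  exact ⟨w, w.point, h, mul_ne_zero hc (div_ne_zero h h)⟩

lemma supNormSq_vertexSection_le_one {φ : Δ.lineBundle.SmoothMetric} {C : ℝ}
    (hC : IsPolydiscBound φ C) (w : Δ.Vertex) :
    (vertexSection w (Real.exp (-C / 2) : ℝ)).supNormSq (φ.tensorPower 1) ≤ 1 := by
  refine iSup_le fun u => iSup₂_le fun p hu => ?_
  rw [ENNReal.ofReal_le_one]
  obtain ⟨u', hu', hchart, hle⟩ := exists_norm_chart_le_one p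
  change p.coord (Vertex.toLatticePoint u) ≠ 0 at hu
  change ‖(Real.exp (-C / 2) : ℂ) * (p.coord w.toLatticePoint /
    p.coord (Vertex.toLatticePoint u))‖ ^ 2 * Real.exp (-(((1 : ℕ) : ℝ) * φ.φ u p)) ≤ 1
  have h1 : φ.φ u p = φ.φ u' p + Real.log (‖p.coord u'.toLatticePoint /
    p.coord (Vertex.toLatticePoint u)‖ ^ 2) := φ.compatible u u' p ⟨hu, hu'⟩
  have h2 := (abs_le.1 (hC u' p hu' hchart)).1
  have hpos : 0 < ‖p.coord u'.toLatticePoint / p.coord (Vertex.toLatticePoint u)‖ ^ 2 := by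
    have := norm_pos_iff.2 (div_ne_zero hu' hu)
    positivity
  have h3 : Real.exp (φ.φ u p) = Real.exp (φ.φ u' p) *
      ‖p.coord u'.toLatticePoint / p.coord (Vertex.toLatticePoint u)‖ ^ 2 := by
    rw [h1, Real.exp_add, Real.exp_log hpos]
  have h4 : ‖p.coord w.toLatticePoint / p.coord (Vertex.toLatticePoint u)‖ ^ 2 ≤
      ‖p.coord u'.toLatticePoint / p.coord (Vertex.toLatticePoint u)‖ ^ 2 := by
    rw [norm_div, norm_div]
    gcongr
    exact hle _
  have h5 : ‖(Real.exp (-C / 2) : ℂ)‖ ^ 2 = Real.exp (-C) := by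
    rw [Complex.norm_real, Real.norm_of_nonneg (Real.exp_pos _).le,
      ← Real.exp_nat_mul]
    congr 1
    push_cast
    ring
  rw [Nat.cast_one, one_mul, Real.exp_neg, ← div_eq_mul_inv, div_le_one (Real.exp_pos _), h3,
    norm_mul, mul_pow, h5]
  exact mul_le_mul (Real.exp_le_exp.2 h2) h4 (sq_nonneg _) (Real.exp_pos _).le

/-! ### The canonical growth function -/

/-- The supremum of the functions `k⁻¹ ln |s_hom|²`, before regularization. -/
def leadingPartSup (φ : Δ.lineBundle.SmoothMetric) (ξ : Fin n → ℂ) : EReal :=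
  ⨆ (k : ℕ) (_ : 1 ≤ k) (s : (Δ.lineBundle.tensorPower k).HolomorphicSection)
    (_ : s.IsNonzero ∧ s.supNormSq (φ.tensorPower k) ≤ 1),
    (((k : ℝ)⁻¹ : ℝ) : EReal) * ENNReal.log (‖s.hom v v.point ξ‖ₑ ^ 2)

lemma subMeanValue_leadingPartSup (φ : Δ.lineBundle.SmoothMetric) :
    SubMeanValue (v.leadingPartSup φ) := by
  refine SubMeanValue.iSup fun k => SubMeanValue.iSup fun hk => SubMeanValue.iSup fun s =>
    SubMeanValue.iSup fun _ => ?_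
  simp only [hom_point]
  have hk0 : (0 : ℝ) < k := by exact_mod_cast hk
  exact subMeanValue_mul_log_enorm_sq (fun z w => differentiable_leadingPart_line _ _ _ _)
    (inv_pos.2 hk0)

lemma exists_leadingPartSup_bounds (φ : Δ.lineBundle.SmoothMetric) {k : ℕ} (hk : 1 ≤ k) :
    ∃ C : ℝ, ∀ ξ : Fin n → ℂ,
      v.leadingPartSup φ ξ ≤ ((v.toricGrowthFunction k ξ + C : ℝ) : EReal) ∧
      ((v.toricGrowthFunction k ξ - C : ℝ) : EReal) ≤ v.leadingPartSup φ ξ := by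
  obtain ⟨C, hC⟩ := exists_isPolydiscBound φ
  obtain ⟨D, hD⟩ := v.exists_abs_toricGrowthFunction_sub_le hk
  refine ⟨C + D, fun ξ => ?_⟩
  obtain ⟨w, hw⟩ := v.exists_dominant ξ
  have hT := abs_le.1 (hD ξ w hw)
  constructor
  · refine iSup₂_le fun l hl => iSup₂_le fun s hs => ?_
    refine (v.inv_mul_log_hom_le hC hl hs.2 hw).trans (EReal.coe_le_coe_iff.2 ?_)
    linarith [hT.1]
  · have hc : ((Real.exp (-C / 2) : ℝ) : ℂ) ≠ 0 := by
      exact_mod_cast (Real.exp_pos _).ne'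
    have hm : v.monomials ξ w.toLatticePoint ≠ 0 :=
      norm_pos_iff.1 (one_pos.trans_le hw.one_le_norm)
    refine le_iSup₂_of_le 1 le_rfl (le_iSup₂_of_le (vertexSection w (Real.exp (-C / 2) : ℝ))
      ⟨isNonzero_vertexSection w hc, supNormSq_vertexSection_le_one hC w⟩ ?_)
    rw [v.hom_vertexSection w hc, log_enorm_sq (mul_ne_zero hc hm), ← EReal.coe_mul,
      EReal.coe_le_coe_iff, norm_mul, Complex.norm_real, Real.norm_of_nonneg (Real.exp_pos _).le,
      Real.log_mul (Real.exp_pos _).ne' (norm_ne_zero_iff.2 hm), Real.log_exp]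
    push_cast
    linarith [hT.2]

/-- The bounds of the unregularized supremum by continuous functions survive the regularization. -/
lemma exists_limsup_leadingPartSup_bounds (φ : Δ.lineBundle.SmoothMetric) {k : ℕ} (hk : 1 ≤ k) :
    ∃ C : ℝ, ∀ ξ : Fin n → ℂ,
      limsup (v.leadingPartSup φ) (𝓝 ξ) ≤ ((v.toricGrowthFunction k ξ + C : ℝ) : EReal) ∧
      ((v.toricGrowthFunction k ξ - C : ℝ) : EReal) ≤ limsup (v.leadingPartSup φ) (𝓝 ξ) := by
  obtain ⟨C, hC⟩ := v.exists_leadingPartSup_bounds φ hk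
  have hT := v.continuous_toricGrowthFunction k
  refine ⟨C, fun ξ => ⟨?_, ?_⟩⟩
  · have h : Continuous fun η => ((v.toricGrowthFunction k η + C : ℝ) : EReal) :=
      continuous_coe_real_ereal.comp (hT.add continuous_const)
    rw [← (h.tendsto ξ).limsup_eq]
    exact limsup_le_limsup (Eventually.of_forall fun η => (hC η).1)
  · have h : Continuous fun η => ((v.toricGrowthFunction k η - C : ℝ) : EReal) :=
      continuous_coe_real_ereal.comp (hT.sub continuous_const)
    rw [← (h.tendsto ξ).limsup_eq]
    exact limsup_le_limsup (Eventually.of_forall fun η => (hC η).2)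

lemma isPlurisubharmonic_canonicalGrowthFunction (φ : Δ.lineBundle.SmoothMetric) :
    IsPlurisubharmonic (Δ.lineBundle.canonicalGrowthFunction φ v.point v) := by
  have h : IsPlurisubharmonic fun ξ : Fin n → ℂ => limsup (v.leadingPartSup φ) (𝓝 ξ) := by
    refine (v.subMeanValue_leadingPartSup φ).isPlurisubharmonic_limsup fun ξ => ?_
    obtain ⟨C, hC⟩ := v.exists_limsup_leadingPartSup_bounds φ le_rfl
    exact ((hC ξ).1.trans_lt (EReal.coe_lt_top _)).ne
  exact h

lemma boundedDifference_canonical_toric (φ : Δ.lineBundle.SmoothMetric) {k : ℕ} (hk : 1 ≤ k) :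
    BoundedDifference (Δ.lineBundle.canonicalGrowthFunction φ v.point v)
      (v.tangentToricGrowthFunction k v.point) := by
  obtain ⟨C, hC⟩ := v.exists_limsup_leadingPartSup_bounds φ hk
  rw [tangentToricGrowthFunction_point]
  refine ⟨C, fun ξ => ⟨?_, ?_⟩⟩
  · rw [← EReal.coe_add]
    exact (hC ξ).1
  · have h := add_le_add_left (hC ξ).2 (C : EReal)
    rw [← EReal.coe_add, sub_add_cancel] at h
    exact h

end Vertex

end DelzantPolytope

end

theorem mainTheorem8 {n : ℕ} (Δ : DelzantPolytope n) (p : Δ.ToricManifold)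
    (hp : ∀ t : Fin n → ℂˣ, DelzantPolytope.torusAction t p = p) :
    ∃ v : Δ.Vertex, v.point = p ∧
      ∀ (φ : Δ.lineBundle.SmoothMetric) (i : Δ.lineBundle.ι), p ∈ Δ.lineBundle.U i →
        ∀ k : ℕ, 1 ≤ k →
          ∃ (h₁ : IsPlurisubharmonic (Δ.lineBundle.canonicalGrowthFunction φ p i))
            (h₂ : IsPlurisubharmonic (v.tangentToricGrowthFunction k p)),
            GrowthCondition.mk (Δ.lineBundle.canonicalGrowthFunction φ p i) h₁ =
              GrowthCondition.mk (v.tangentToricGrowthFunction k p) h₂ := by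
  obtain ⟨v, hv⟩ := DelzantPolytope.exists_coord_ne_zero p
  have hvp := v.point_eq_of_forall_torusAction_eq hv hp
  subst hvp
  refine ⟨v, rfl, fun φ i hi k hk => ?_⟩
  -- The fixed point lies in no other chart, so the trivialization can only be the one at `v`.
  obtain rfl : v = i := (v.eq_of_coord_point_ne_zero hi).symm
  refine ⟨DelzantPolytope.Vertex.isPlurisubharmonic_canonicalGrowthFunction v φ, ?_,
    Quotient.sound (DelzantPolytope.Vertex.boundedDifference_canonical_toric v φ hk)⟩
  rw [DelzantPolytope.Vertex.tangentToricGrowthFunction_point]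
  exact DelzantPolytope.Vertex.isPlurisubharmonic_toricGrowthFunction v k
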